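/- Fix countably infinite sets of atomic propositions, agents and epistemic skills. A weighted Kripke model $M=(W,E,C,\beta)$ consists of a nonempty set $W$ of worlds, an edge function $E$ that assigns a set of skills to each pair of worlds, with $E(w,u)=E(u,w)$ for all $w,u$, and $w=u$ whenever $E(w,u)$ is the set of all skills, a capability function $C$ that assigns a set of skills to each agent, and a valuation $\beta$ that assigns a set of atoms to each world. The basic language has the formulas $$\phi ::= p \mid \neg\phi \mid (\phi\to\phi) \mid K_a\phi ,$$ and it can be extended by any of the eight kinds of modalities $C_G\phi$, $D_G\phi$, $E_G\phi$, $F_G\phi$, $(+_S)_a\phi$, $(-_S)_a\phi$, $(=_S)_a\phi$, $(\equiv_b)_a\phi$, where $a,b$ are agents, $G$ is a finite nonempty set of agents and $S$ is a finite set of skills. Truth at a world $w$ of $M$ is defined by: - $p$ holds iff $p\in\beta(w)$; negation and implication are classical; - $K_a\psi$ holds iff $\psi$ holds at all $u\in W$ with $C(a)\subseteq E(w,u)$; - $E_G\psi$ (mutual knowledge) holds iff $K_a\psi$ holds for all $a\in G$; - $C_G\psi$ (common knowledge) holds iff $E_G^n\psi$ holds for all $n\ge 1$, where $E_G^1\psi=E_G\psi$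 and $E_G^{n+1}\psi=E_GE_G^n\psi$; - $D_G\psi$ (distributed knowledge) holds iff $\psi$ holds at all $u\in W$ with $\bigcup_{a\in G}C(a)\subseteq E(w,u)$; - $F_G\psi$ (field knowledge) holds iff $\psi$ holds at all $u\in W$ with $\bigcap_{a\in G}C(a)\subseteq E(w,u)$; - $(+_S)_a\psi$ (upskilling), $(-_S)_a\psi$ (downskilling), $(=_S)_a\psi$ (reskilling) and $(\equiv_b)_a\psi$ (learning) hold iff $\psi$ holds at $w$ in the model obtained from $M$ by replacing $C(a)$ by $C(a)\cup S$, $C(a)\setminus S$, $S$ and $C(b)$, respectively. The model checking problem for one of these languages is to decide, given a finite model $M$, a world $w$ of $M$ and a formula $\phi$ of the language, whether $\phi$ is true at $w$ in $M$. Inputs are strings over a fixed finite alphabet: atoms, agents, skills and worlds are named by binary strings; $M$ is given by the list of its worlds and by finite lists of triples $(w,u,S)$ for $E$ (read symmetrically), of pairs $(a,S)$ for $C$ and of pairs $(w,\Phi)$ for $\beta$, with finite sets $S,\Phi$ written as lists of their elements (arguments that are not listed get the empty set, and several entries for one argument are joined). **Theorem.** The model checking problem for the language with all eight kinds of modalities,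 and for each of its sublanguages obtained by keeping any subset of the eight kinds, is in $\mathsf P$: there is a deterministic Turing machine that decides, in time polynomial in the length of the input string, the set of strings that encode some $(M,w,\phi)$ with $\phi$ in the language and $\phi$ true at $w$ in $M$. -/

import Mathlib

namespace WeightedEpistemic

/-! ### Parameters: countably infinite supplies of names -/

/-- Names are finite binary strings. They serve as atoms, agents and skills, and as the names of the
worlds of a finite model, so that every object occurring in an input is itself a string. -/
abbrev Name := List Bool

/-- Atomic propositions. -/
abbrev Atom := Name

/-- Agents. -/
abbrev Agent := Name

/-- Epistemic skills. -/
abbrev Skill := Name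

/-- Finite nonempty groups of agents. -/
abbrev Group := {G : Finset Agent // G.Nonempty}

/-! ### Formulas -/

/-- The eight optional kinds of modalities. -/
inductive Feature
  /-- common knowledge `C_G` -/
  | common
  /-- distributed knowledge `D_G` -/
  | distributed
  /-- mutual knowledge `E_G` -/
  | mutual
  /-- field knowledge `F_G` -/
  | field
  /-- upskilling `(+_S)_a` -/
  | upskill
  /-- downskilling `(-_S)_a` -/
  | downskill
  /-- reskilling `(=_S)_a` -/
  | reskill
  /-- learning `(≡_b)_a` -/
  | learn
  deriving DecidableEq

instance : Fintype Feature where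
  elems := {.common, .distributed, .mutual, .field, .upskill, .downskill, .reskill, .learn}
  complete f := by cases f <;> decide

/-- Formulas with all eight kinds of modalities (and no quantifying modalities). A formula is a
finite expression, so the skill sets written in it are finite. -/
inductive Formula
  | atom (p : Atom)
  | neg (φ : Formula)
  | imp (φ ψ : Formula)
  /-- individual knowledge `K_a φ` -/
  | know (a : Agent) (φ : Formula)
  /-- common knowledge `C_G φ` -/
  | common (G : Group) (φ : Formula)
  /-- distributed knowledge `D_G φ` -/
  | distributed (G : Group) (φ : Formula)
  /-- mutual knowledge `E_G φ` -/
  | mutual (G : Group) (φ : Formula)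
  /-- field knowledge `F_G φ` -/
  | field (G : Group) (φ : Formula)
  /-- upskilling `(+_S)_a φ` -/
  | upskill (S : Finset Skill) (a : Agent) (φ : Formula)
  /-- downskilling `(-_S)_a φ` -/
  | downskill (S : Finset Skill) (a : Agent) (φ : Formula)
  /-- reskilling `(=_S)_a φ` -/
  | reskill (S : Finset Skill) (a : Agent) (φ : Formula)
  /-- learning `(≡_b)_a φ` -/
  | learn (b a : Agent) (φ : Formula)

/-- `φ.InLanguage X`: the formula `φ` belongs to the extension of the basic language (atoms,
Boolean operators and `K_a`) with exactly the kinds of modalities in `X`. -/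
def Formula.InLanguage (X : Set Feature) : Formula → Prop
  | .atom _ => True
  | .neg φ => φ.InLanguage X
  | .imp φ ψ => φ.InLanguage X ∧ ψ.InLanguage X
  | .know _ φ => φ.InLanguage X
  | .common _ φ => Feature.common ∈ X ∧ φ.InLanguage X
  | .distributed _ φ => Feature.distributed ∈ X ∧ φ.InLanguage X
  | .mutual _ φ => Feature.mutual ∈ X ∧ φ.InLanguage X
  | .field _ φ => Feature.field ∈ X ∧ φ.InLanguage X
  | .upskill _ _ φ => Feature.upskill ∈ X ∧ φ.InLanguage X
  | .downskill _ _ φ => Feature.downskill ∈ X ∧ φ.InLanguage X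
  | .reskill _ _ φ => Feature.reskill ∈ X ∧ φ.InLanguage X
  | .learn _ _ φ => Feature.learn ∈ X ∧ φ.InLanguage X

/-! ### Models and truth -/

/-- A weighted Kripke model with set of worlds `W`. -/
structure WeightedModel (W : Type) where
  nonempty : Nonempty W
  /-- the edge function -/
  E : W → W → Set Skill
  /-- the capability function -/
  C : Agent → Set Skill
  /-- the valuation -/
  β : W → Set Atom
  positivity : ∀ w u, E w u = Set.univ → w = u
  symmetry : ∀ w u, E w u = E u w

namespace WeightedModel

variable {W : Type}

/-- The model that differs from `M` only in that agent `a` has the skill set `S`. -/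
def setSkills (M : WeightedModel W) (a : Agent) (S : Set Skill) : WeightedModel W :=
  { M with C := Function.update M.C a S }

/-- `a` knows `P` at `w`. -/
def Knows (M : WeightedModel W) (a : Agent) (P : W → Prop) (w : W) : Prop :=
  ∀ u, M.C a ⊆ M.E w u → P u

/-- Everyone in `G` knows `P` at `w`. -/
def EveryoneKnows (M : WeightedModel W) (G : Group) (P : W → Prop) (w : W) : Prop :=
  ∀ a ∈ G.1, M.Knows a P w

end WeightedModel

/-- `φ.Sat M w`: the formula `φ` is true at the world `w` of the model `M`. -/
def Formula.Sat {W : Type} : Formula → WeightedModel W → W → Prop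
  | .atom p, M, w => p ∈ M.β w
  | .neg φ, M, w => ¬ φ.Sat M w
  | .imp φ ψ, M, w => φ.Sat M w → ψ.Sat M w
  | .know a φ, M, w => M.Knows a (φ.Sat M) w
  | .common G φ, M, w => ∀ n : ℕ, 1 ≤ n → (M.EveryoneKnows G)^[n] (φ.Sat M) w
  | .distributed G φ, M, w => ∀ u, (⋃ a ∈ G.1, M.C a) ⊆ M.E w u → φ.Sat M u
  | .mutual G φ, M, w => M.EveryoneKnows G (φ.Sat M) w
  | .field G φ, M, w => ∀ u, (⋂ a ∈ G.1, M.C a) ⊆ M.E w u → φ.Sat M u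
  | .upskill S a φ, M, w => φ.Sat (M.setSkills a (M.C a ∪ ↑S)) w
  | .downskill S a φ, M, w => φ.Sat (M.setSkills a (M.C a \ ↑S)) w
  | .reskill S a φ, M, w => φ.Sat (M.setSkills a ↑S) w
  | .learn b a φ, M, w => φ.Sat (M.setSkills a (M.C b)) w

/-- The clause for common knowledge in terms of the formulas `E_G^n φ`. -/
theorem Formula.sat_common_iff {W : Type} (G : Group) (φ : Formula) (M : WeightedModel W) (w : W) :
    (Formula.common G φ).Sat M w ↔ ∀ n : ℕ, 1 ≤ n → ((Formula.mutual G)^[n] φ).Sat M w := by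
  have h : ∀ n : ℕ, (M.EveryoneKnows G)^[n] (φ.Sat M) = ((Formula.mutual G)^[n] φ).Sat M := by
    intro n
    induction n with
    | zero => rfl
    | succ n ih =>
      rw [Function.iterate_succ_apply', Function.iterate_succ_apply', ih]
      rfl
  simp only [Formula.Sat, h]

/-! ### Finite models as finite data -/

/-- A finite presentation of a finite model: a list of worlds, a list of triples `(w, u, S)` for the
edge function, a list of pairs `(a, S)` for the capability function, and a list of pairs `(w, Φ)`
for the valuation. Finite sets are given by lists of their elements. -/
structure ModelData where
  worlds : List Name
  worlds_ne_nil : worlds ≠ []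
  edges : List (Name × Name × List Skill)
  capabilities : List (Agent × List Skill)
  valuation : List (Name × List Atom)

namespace ModelData

/-- The worlds of the presented model. -/
abbrev World (D : ModelData) : Type := {w : Name // w ∈ D.worlds}

/-- The skills which the list of triples gives for the unordered pair `{w, u}`. -/
def edgeSet (D : ModelData) (w u : Name) : Set Skill :=
  {s | ∃ S : List Skill, ((w, u, S) ∈ D.edges ∨ (u, w, S) ∈ D.edges) ∧ s ∈ S}

theorem edgeSet_finite (D : ModelData) (w u : Name) : (D.edgeSet w u).Finite := by
  refine Set.Finite.subset (List.finite_toSet (D.edges.flatMap fun t => t.2.2)) ?_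
  rintro s ⟨S, h | h, hs⟩
  · exact List.mem_flatMap.2 ⟨_, h, hs⟩
  · exact List.mem_flatMap.2 ⟨_, h, hs⟩

/-- The presented model. A triple `(w, u, S)` describes `E(w, u) = E(u, w)`; the sets of agents,
pairs of worlds or worlds that are not listed are empty, and several entries for the same argument
are joined. Every finite model in which the sets `E(w, u)`, `C(a)` and `β(w)` are finite, and `C(a)`
is nonempty for finitely many agents only, arises in this way up to the names of its worlds. -/
def toModel (D : ModelData) : WeightedModel D.World where
  nonempty := by
    obtain ⟨w, hw⟩ := List.exists_mem_of_ne_nil _ D.worlds_ne_nil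
    exact ⟨⟨w, hw⟩⟩
  E w u := D.edgeSet w.1 u.1
  C a := {s | ∃ S : List Skill, (a, S) ∈ D.capabilities ∧ s ∈ S}
  β w := {p | ∃ Φ : List Atom, (w.1, Φ) ∈ D.valuation ∧ p ∈ Φ}
  positivity w u h := by
    have hf := D.edgeSet_finite w.1 u.1
    rw [h] at hf
    exact absurd hf Set.infinite_univ
  symmetry w u := by
    ext s
    simp only [edgeSet, Set.mem_ofPred_eq, or_comm]

end ModelData

/-! ### Inputs as strings over a finite alphabet -/

/-- The finite alphabet in which inputs are written. -/
inductive Sym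
  /-- a bit of a name -/
  | bit (b : Bool)
  /-- the end of a name -/
  | stop_mark
  /-- the beginning of a list -/
  | bra
  /-- the end of a list -/
  | ket
  | neg
  | imp
  | know
  /-- the operator of an optional modality -/
  | op (f : Feature)
  deriving DecidableEq, Fintype

/-- The string for a name. -/
def writeName (s : Name) : List Sym := s.map Sym.bit ++ [Sym.stop_mark]

/-- The string for a list of names. -/
def writeNames (l : List Name) : List Sym := Sym.bra :: (l.flatMap writeName ++ [Sym.ket])

/-- The string for a finite model. -/
def ModelData.write (D : ModelData) : List Sym :=
  writeNames D.worlds ++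
  (Sym.bra ::
    ((D.edges.flatMap fun t => writeName t.1 ++ writeName t.2.1 ++ writeNames t.2.2) ++
      [Sym.ket])) ++
  (Sym.bra ::
    ((D.capabilities.flatMap fun t => writeName t.1 ++ writeNames t.2) ++ [Sym.ket])) ++
  (Sym.bra ::
    ((D.valuation.flatMap fun t => writeName t.1 ++ writeNames t.2) ++ [Sym.ket]))

/-- `φ.WrittenAs x`: the string `x` is a way of writing the formula `φ` in prefix notation. The
elements of a finite set may be written in any order. -/
inductive Formula.WrittenAs : Formula → List Sym → Prop
  | atom (p : Atom) : WrittenAs (.atom p) (writeName p)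
  | neg {φ : Formula} {x : List Sym} : WrittenAs φ x → WrittenAs (.neg φ) (Sym.neg :: x)
  | imp {φ ψ : Formula} {x y : List Sym} : WrittenAs φ x → WrittenAs ψ y →
      WrittenAs (.imp φ ψ) (Sym.imp :: (x ++ y))
  | know (a : Agent) {φ : Formula} {x : List Sym} : WrittenAs φ x →
      WrittenAs (.know a φ) (Sym.know :: (writeName a ++ x))
  | common (G : Group) (l : List Agent) {φ : Formula} {x : List Sym} : l.toFinset = G.1 →
      WrittenAs φ x → WrittenAs (.common G φ) (Sym.op .common :: (writeNames l ++ x))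
  | distributed (G : Group) (l : List Agent) {φ : Formula} {x : List Sym} : l.toFinset = G.1 →
      WrittenAs φ x → WrittenAs (.distributed G φ) (Sym.op .distributed :: (writeNames l ++ x))
  | mutual (G : Group) (l : List Agent) {φ : Formula} {x : List Sym} : l.toFinset = G.1 →
      WrittenAs φ x → WrittenAs (.mutual G φ) (Sym.op .mutual :: (writeNames l ++ x))
  | field (G : Group) (l : List Agent) {φ : Formula} {x : List Sym} : l.toFinset = G.1 →
      WrittenAs φ x → WrittenAs (.field G φ) (Sym.op .field :: (writeNames l ++ x))
  | upskill (S : Finset Skill) (l : List Skill) (a : Agent) {φ : Formula} {x : List Sym} :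
      l.toFinset = S → WrittenAs φ x →
      WrittenAs (.upskill S a φ) (Sym.op .upskill :: (writeNames l ++ writeName a ++ x))
  | downskill (S : Finset Skill) (l : List Skill) (a : Agent) {φ : Formula} {x : List Sym} :
      l.toFinset = S → WrittenAs φ x →
      WrittenAs (.downskill S a φ) (Sym.op .downskill :: (writeNames l ++ writeName a ++ x))
  | reskill (S : Finset Skill) (l : List Skill) (a : Agent) {φ : Formula} {x : List Sym} :
      l.toFinset = S → WrittenAs φ x →
      WrittenAs (.reskill S a φ) (Sym.op .reskill :: (writeNames l ++ writeName a ++ x))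
  | learn (b a : Agent) {φ : Formula} {x : List Sym} : WrittenAs φ x →
      WrittenAs (.learn b a φ) (Sym.op .learn :: (writeName b ++ writeName a ++ x))

/-- The model checking problem for the language with the modalities in `X`, as a set of strings: the
strings that write a finite model `M`, a world `w` of `M` and a formula `φ` of the language such
that `φ` is true at `w` in `M`. -/
def modelChecking (X : Set Feature) : Set (List Sym) :=
  {z | ∃ (D : ModelData) (w : D.World) (φ : Formula) (x : List Sym),
    φ.InLanguage X ∧ φ.WrittenAs x ∧ z = D.write ++ writeName w.1 ++ x ∧ φ.Sat D.toModel w}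

/-! ### The complexity class P -/

/-- The class P: a set `L` of strings over the alphabet `Γ` is in P if its characteristic function is
computed by a (multi-stack) Turing machine within a number of steps that is bounded by a polynomial
in the length of the string. -/
def InP {Γ : Type} (L : Set (List Γ)) : Prop :=
  ∃ f : List Γ → Bool, (∀ z, f z = true ↔ z ∈ L) ∧
    Nonempty (Turing.TM2ComputableInPolyTime (id : List Γ → List Γ) Computability.encodeBool f)

end WeightedEpistemic

/-! The formula is evaluated bottom-up: for every occurrence of a subformula one computes the set of
worlds at which it is true. The update modalities change only the capability function, and the
updates in force at an occurrence are those written above it in the syntax tree, whatever the world.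
So each occurrence is evaluated in a single model, given by the input and a list of updates no
longer than the formula. Whether an agent has a skill after these updates is found by tracing the
question back through the list (`ModelData.skillMem_iff`). A knowledge clause asks for inclusions
between sets of skills, and only skills written in the input matter (`ModelData.mem_skills`). Common
knowledge is the limit of the decreasing sets of worlds at which `E_G^1 φ, ..., E_G^k φ` all hold.
Since `E_G` commutes with conjunctions, each of these sets determines the next, so the limit is
reached after at most as many steps as there are worlds (`ModelData.mem_common_iff`).

To turn this into a Turing machine, structured programs on stacks are compiled to `TM2` machines
with exact step counts (`Exec.evals`). Data are binary trees on one stack. The functions computable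
in polynomial time on trees are closed under composition, pairing, branching and, as long as all
intermediate values stay polynomially small, iteration along a list (`PolyTime.iterate`). Folds, and
with them the parsers and the evaluation, follow; the real work there is bounding the sizes of the
states. `inP_of_polyTime` passes from trees back to strings.

Formulas are handled as sequences of tokens in Polish notation. Scanning left to right annotates
each token with the updates in whose scope it is; scanning back evaluates with a stack of sets of
worlds. `Formula.WrittenAs.exists_isTokens` shows that this is correct on formulas, and
`exists_formulas` that the sequences accepted by counting are formulas. -/

namespace WeightedEpistemic

open Turing

/-! ### A structured language for stack machines -/

/-- The working stacks: the stack of values, two scratch stacks and a counter. -/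
inductive Reg
  | val
  | aux
  | aux'
  | cnt
  deriving DecidableEq

instance : Fintype Reg where
  elems := {.val, .aux, .aux', .cnt}
  complete r := by cases r <;> decide

/-- The stacks: the working stacks and the input stack. -/
abbrev Stack := Option Reg

/-- Working stacks contain bits, the input stack contains symbols. -/
abbrev StackSym : Stack → Type
  | some _ => Bool
  | none => Sym

/-- The finite memory holds the most recently read letter. -/
abbrev Buf := Option (Bool ⊕ Sym)

/-- The buffer after a letter was read from the stack `k`. -/
def toBuf : (k : Stack) → Option (StackSym k) → Buf
  | some _, b => b.map Sum.inl
  | none, s => s.map Sum.inr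

/-- The contents of all stacks. -/
abbrev Stacks := ∀ k, List (StackSym k)

/-- Structured programs for stack machines. -/
inductive Cmd
  | push (k : Reg) (f : Buf → Bool)
  | pop (k : Stack)
  | load (f : Buf → Buf)
  | seq (c d : Cmd)
  | case (f : Buf → Cmd)
  | loop (f : Buf → Bool) (c : Cmd)

/-- `Exec c s s' n`: the program `c` leads from the state `s` to the state `s'` in `n` steps. -/
inductive Exec : Cmd → Buf × Stacks → Buf × Stacks → ℕ → Prop
  | push (k : Reg) (f : Buf → Bool) (v : Buf) (S : Stacks) :
      Exec (.push k f) (v, S) (v, Function.update S (some k) (f v :: S (some k))) 1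
  | pop (k : Stack) (v : Buf) (S : Stacks) :
      Exec (.pop k) (v, S) (toBuf k (S k).head?, Function.update S k (S k).tail) 1
  | load (f : Buf → Buf) (v : Buf) (S : Stacks) : Exec (.load f) (v, S) (f v, S) 1
  | seq {c d : Cmd} {s s' s'' : Buf × Stacks} {m n : ℕ} :
      Exec c s s' m → Exec d s' s'' n → Exec (.seq c d) s s'' (m + n)
  | case {f : Buf → Cmd} {s s' : Buf × Stacks} {n : ℕ} :
      Exec (f s.1) s s' n → Exec (.case f) s s' (1 + n)
  | loop_done {f : Buf → Bool} {c : Cmd} {s : Buf × Stacks} :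
      f s.1 = false → Exec (.loop f c) s s 1
  | loop_step {f : Buf → Bool} {c : Cmd} {s s' s'' : Buf × Stacks} {m n : ℕ} :
      f s.1 = true → Exec c s s' m → Exec (.loop f c) s' s'' n →
      Exec (.loop f c) s s'' (1 + m + n)

namespace Cmd

/-- The labels of the compiled program. -/
def Lab : Cmd → Type
  | .push _ _ => Unit
  | .pop _ => Unit
  | .load _ => Unit
  | .seq c d => c.Lab ⊕ d.Lab
  | .case f => Option (Σ v, (f v).Lab)
  | .loop _ c => Option c.Lab

noncomputable instance fintypeLab : (c : Cmd) → Fintype c.Lab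
  | .push _ _ => inferInstanceAs (Fintype Unit)
  | .pop _ => inferInstanceAs (Fintype Unit)
  | .load _ => inferInstanceAs (Fintype Unit)
  | .seq c d =>
    letI := fintypeLab c
    letI := fintypeLab d
    inferInstanceAs (Fintype (c.Lab ⊕ d.Lab))
  | .case f =>
    letI := fun v => fintypeLab (f v)
    inferInstanceAs (Fintype (Option (Σ v, (f v).Lab)))
  | .loop _ c =>
    letI := fintypeLab c
    inferInstanceAs (Fintype (Option c.Lab))

/-- The label at which the compiled program starts. -/
def entry : (c : Cmd) → c.Lab
  | .push _ _ => ()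
  | .pop _ => ()
  | .load _ => ()
  | .seq c _ => Sum.inl c.entry
  | .case _ => none
  | .loop _ _ => none

/-- The compiled program, whose labels are embedded by `e` into the labels of a machine. It jumps
to `x` when it is done. -/
def code {L : Type} : (c : Cmd) → (e : c.Lab → L) → (x : L) → c.Lab → TM2.Stmt StackSym L Buf
  | .push k f, _, x, _ => .push (some k) f (.goto fun _ => x)
  | .pop k, _, x, _ => .pop k (fun _ => toBuf k) (.goto fun _ => x)
  | .load f, _, x, _ => .load f (.goto fun _ => x)
  | .seq c d, e, x, l => match l with
    | .inl l => c.code (fun l => e (.inl l)) (e (.inr d.entry)) l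
    | .inr l => d.code (fun l => e (.inr l)) x l
  | .case f, e, x, l => match l with
    | none => .goto fun v => e (some ⟨v, (f v).entry⟩)
    | some ⟨v, l⟩ => (f v).code (fun l => e (some ⟨v, l⟩)) x l
  | .loop f c, e, x, l => match l with
    | none => .branch f (.goto fun _ => e (some c.entry)) (.goto fun _ => x)
    | some l => c.code (fun l => e (some l)) (e none) l

theorem iterate_step_one {L : Type} {m : L → TM2.Stmt StackSym L Buf} {l : L}
    {q : TM2.Stmt StackSym L Buf} (h : m l = q) (v : Buf) (S : Stacks) :
    (flip bind (TM2.step m))^[1] (some ⟨some l, v, S⟩) = some (TM2.stepAux q v S) := by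
  subst h
  rfl

/-- Induction on the run, for all embeddings of the labels and all exits at once: the first part of
a sequence exits to the entry of the second, and the body of a loop to the loop test. Step counts
are exact, so iterates of the step function simply add up. -/
theorem _root_.WeightedEpistemic.Exec.evals {c : Cmd} {s s' : Buf × Stacks} {n : ℕ}
    (h : Exec c s s' n) {L : Type} (m : L → TM2.Stmt StackSym L Buf) (e : c.Lab → L) (x : L)
    (hm : ∀ l, m (e l) = c.code e x l) :
    (flip bind (TM2.step m))^[n] (some ⟨some (e c.entry), s.1, s.2⟩) =
      some ⟨some x, s'.1, s'.2⟩ := by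
  induction h generalizing x with
  | push k f v S | pop k v S | load f v S => exact iterate_step_one (hm ()) _ _
  | @seq c d s s' s'' m' n' _ _ ih ih' =>
    rw [add_comm, Function.iterate_add_apply]
    have h1 := ih (fun l => e (.inl l)) (e (.inr d.entry)) fun l => hm (.inl l)
    have h2 := ih' (fun l => e (.inr l)) x fun l => hm (.inr l)
    exact (congrArg _ h1).trans h2
  | @case f s s' n' _ ih =>
    rw [add_comm, Function.iterate_add_apply]
    have h1 := ih (fun l => e (some ⟨s.1, l⟩)) x fun l => hm (some ⟨s.1, l⟩)
    exact (congrArg _ (iterate_step_one (hm none) _ _)).trans h1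
  | @loop_done f c s hf =>
    refine (iterate_step_one (hm none) _ _).trans ?_
    simp only [code, TM2.stepAux, hf, cond_false]
  | @loop_step f c s s' s'' m' n' hf _ _ ih ih' =>
    rw [show 1 + m' + n' = n' + (m' + 1) by ring, Function.iterate_add_apply,
      Function.iterate_add_apply]
    have h1 := ih (fun l => e (some l)) (e none) fun l => hm (some l)
    have h2 := ih' e x hm
    refine (congrArg _ ((congrArg _ ((iterate_step_one (hm none) _ _).trans ?_)).trans h1)).trans h2
    simp only [code, TM2.stepAux, hf, cond_true]

end Cmd

/-- `Runs c s s' t`: the program `c` leads from `s` to `s'` in at most `t` steps. -/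
def Runs (c : Cmd) (s s' : Buf × Stacks) (t : ℕ) : Prop :=
  ∃ n ≤ t, Exec c s s' n

namespace Runs

variable {c d : Cmd} {s s' s'' : Buf × Stacks} {t t' : ℕ}

theorem mono (h : Runs c s s' t) (ht : t ≤ t') : Runs c s s' t' := by
  obtain ⟨n, hn, h⟩ := h
  exact ⟨n, hn.trans ht, h⟩

theorem cast (h : Runs c s s' t) (hs : s' = s'') : Runs c s s'' t :=
  hs ▸ h

theorem of_eq (h : Runs c s s' t) (hs : s'' = s) : Runs c s'' s' t :=
  hs ▸ h

theorem seq (h : Runs c s s' t) (h' : Runs d s' s'' t') : Runs (.seq c d) s s'' (t + t') := by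
  obtain ⟨n, hn, h⟩ := h
  obtain ⟨n', hn', h'⟩ := h'
  exact ⟨n + n', by omega, h.seq h'⟩

theorem case {f : Buf → Cmd} (h : Runs (f s.1) s s' t) : Runs (.case f) s s' (1 + t) := by
  obtain ⟨n, hn, h⟩ := h
  exact ⟨1 + n, by omega, h.case⟩

theorem loop_done {f : Buf → Bool} (h : f s.1 = false) : Runs (.loop f c) s s 1 :=
  ⟨1, le_rfl, .loop_done h⟩

theorem loop_step {f : Buf → Bool} (hf : f s.1 = true) (h : Runs c s s' t)
    (h' : Runs (.loop f c) s' s'' t') : Runs (.loop f c) s s'' (1 + t + t') := by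
  obtain ⟨n, hn, h⟩ := h
  obtain ⟨n', hn', h'⟩ := h'
  exact ⟨1 + n + n', by omega, .loop_step hf h h'⟩

theorem load (f : Buf → Buf) (v : Buf) (S : Stacks) : Runs (.load f) (v, S) (f v, S) 1 :=
  ⟨1, le_rfl, .load f v S⟩

theorem push (k : Reg) (f : Buf → Bool) (v : Buf) (S : Stacks) :
    Runs (.push k f) (v, S) (v, Function.update S (some k) (f v :: S (some k))) 1 :=
  ⟨1, le_rfl, .push k f v S⟩

theorem pop (k : Stack) (v : Buf) (S : Stacks) :
    Runs (.pop k) (v, S) (toBuf k (S k).head?, Function.update S k (S k).tail) 1 :=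
  ⟨1, le_rfl, .pop k v S⟩

theorem pop_seq (k : Stack) {v : Buf} {S : Stacks}
    (h : Runs d (toBuf k (S k).head?, Function.update S k (S k).tail) s t) :
    Runs (.seq (.pop k) d) (v, S) s (t + 1) :=
  ((pop k v S).seq h).mono (by omega)

theorem push_seq (k : Reg) (f : Buf → Bool) {v : Buf} {S : Stacks}
    (h : Runs d (v, Function.update S (some k) (f v :: S (some k))) s t) :
    Runs (.seq (.push k f) d) (v, S) s (t + 1) :=
  ((push k f v S).seq h).mono (by omega)

theorem load_seq (f : Buf → Buf) {v : Buf} {S : Stacks} (h : Runs d (f v, S) s t) :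
    Runs (.seq (.load f) d) (v, S) s (t + 1) :=
  ((load f v S).seq h).mono (by omega)

/-- Resolves a branch at the head of a sequence without naming the intermediate state, so that
programs can be executed symbolically one instruction at a time. -/
theorem case_seq {f : Buf → Cmd} (h : Runs (.seq (f s.1) d) s s' t) :
    Runs (.seq (.case f) d) s s' (t + 1) := by
  obtain ⟨n, hn, h⟩ := h
  cases h with
  | seq h h' => exact ⟨_, by omega, h.case.seq h'⟩

theorem seq_assoc {e : Cmd} (h : Runs (.seq c (.seq d e)) s s' t) :
    Runs (.seq (.seq c d) e) s s' t := by
  obtain ⟨n, hn, h⟩ := h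
  cases h with
  | seq h h' => cases h' with
    | seq h' h'' => exact ⟨_, by omega, (h.seq h').seq h''⟩

end Runs

/-- The stacks with the given contents. -/
def mkStacks (v a a' c : List Bool) (i : List Sym) : Stacks
  | some .val => v
  | some .aux => a
  | some .aux' => a'
  | some .cnt => c
  | none => i

section

variable (v a a' c x : List Bool) (i y : List Sym)

@[simp] theorem mkStacks_val : mkStacks v a a' c i (some .val) = v := rfl
@[simp] theorem mkStacks_aux : mkStacks v a a' c i (some .aux) = a := rfl
@[simp] theorem mkStacks_aux' : mkStacks v a a' c i (some .aux') = a' := rfl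
@[simp] theorem mkStacks_cnt : mkStacks v a a' c i (some .cnt) = c := rfl
@[simp] theorem mkStacks_none : mkStacks v a a' c i none = i := rfl

@[simp] theorem update_mkStacks_val :
    Function.update (mkStacks v a a' c i) (some .val) x = mkStacks x a a' c i := by
  funext k; rcases k with _ | _ | _ | _ | _ <;> rfl

@[simp] theorem update_mkStacks_aux :
    Function.update (mkStacks v a a' c i) (some .aux) x = mkStacks v x a' c i := by
  funext k; rcases k with _ | _ | _ | _ | _ <;> rfl

@[simp] theorem update_mkStacks_aux' :
    Function.update (mkStacks v a a' c i) (some .aux') x = mkStacks v a x c i := by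
  funext k; rcases k with _ | _ | _ | _ | _ <;> rfl

@[simp] theorem update_mkStacks_cnt :
    Function.update (mkStacks v a a' c i) (some .cnt) x = mkStacks v a a' x i := by
  funext k; rcases k with _ | _ | _ | _ | _ <;> rfl

@[simp] theorem update_mkStacks_none :
    Function.update (mkStacks v a a' c i) none y = mkStacks v a a' c y := by
  funext k; rcases k with _ | _ | _ | _ | _ <;> rfl

end

end WeightedEpistemic

namespace WeightedEpistemic

open Turing

/-! ### Binary trees on the stack of values -/

/-- Binary trees, the universal data type of the programs. -/
inductive Code
  | nil
  | cons (a b : Code)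

namespace Code

/-- The bits which write a tree on a stack. -/
def write : Code → List Bool
  | nil => [false]
  | cons a b => true :: (a.write ++ b.write)

/-- The number of bits of a tree. -/
def size (t : Code) : ℕ := t.write.length

@[simp] theorem size_nil : size nil = 1 := rfl

@[simp] theorem size_cons (a b : Code) : size (cons a b) = 1 + a.size + b.size := by
  simp [size, write]; omega

end Code

/-- The state in which only the stack of values is in use. -/
def valState (v : List Bool) : Buf × Stacks := (none, mkStacks v [] [] [] [])

/-- The buffer with a bit. -/
abbrev bitBuf (b : Bool) : Buf := some (.inl b)

namespace Cmd

/-- Move the contents of one working stack to another one. -/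
def pour (r r' : Reg) : Cmd :=
  .seq (.pop (some r)) (.loop Option.isSome (.seq (.push r' (· = bitBuf true)) (.pop (some r))))

/-- The loop tests a letter that is already popped. Hence the invariant splits `l`: its head is in
the buffer and its tail on the stack. A letter costs a test, a push and a pop; the last test costs
the additional step. -/
theorem runs_pour_loop {r r' : Reg} (h : r ≠ r') (l : List Bool) (S : Stacks)
    (hS : S (some r) = l.tail) :
    Runs (.loop Option.isSome (.seq (.push r' (· = bitBuf true)) (.pop (some r))))
      (l.head?.map .inl, S)
      (none, Function.update (Function.update S (some r) []) (some r')
        (l.reverse ++ S (some r'))) (3 * l.length + 1) := by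
  induction l generalizing S with
  | nil =>
    have : Function.update (Function.update S (some r) []) (some r') (S (some r')) = S := by
      funext k
      rcases eq_or_ne k (some r') with rfl | h1
      · simp_all
      · rcases eq_or_ne k (some r) with rfl | h2 <;> simp_all
    simpa [this] using Runs.loop_done (f := Option.isSome) (s := (none, S)) rfl
  | cons b l ih =>
    set S' : Stacks := Function.update (Function.update S (some r') (b :: S (some r')))
      (some r) l.tail with hS'
    have hr : S' (some r) = l.tail := by simp [hS']
    have h1 := (Runs.push r' (· = bitBuf true) (bitBuf b) S).seq (Runs.pop (some r) _ _)
    have e : (toBuf (some r) (Function.update S (some r') (b :: S (some r')) (some r)).head?) =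
        l.head?.map Sum.inl := by
      simp [toBuf, h, hS]
    have e' : Function.update S (some r') (b :: S (some r')) (some r) = l := by simp [h, hS]
    have hb : (decide (bitBuf b = bitBuf true)) = b := by cases b <;> rfl
    rw [hb, e, e'] at h1
    refine (Runs.loop_step (s := (bitBuf b, S)) rfl h1 (ih _ hr)).mono ?_ |>.cast ?_
    · simp; omega
    · congr 1
      funext k
      rcases eq_or_ne k (some r') with rfl | h1
      · simp_all [Ne.symm h]
      · rcases eq_or_ne k (some r) with rfl | h2 <;> simp_all

theorem runs_pour {r r' : Reg} (h : r ≠ r') (v : Buf) (S : Stacks) :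
    Runs (pour r r') (v, S)
      (none, Function.update (Function.update S (some r) []) (some r')
        ((S (some r)).reverse ++ S (some r'))) (3 * (S (some r)).length + 2) := by
  have h1 := (Runs.pop (some r) v S).seq
    (runs_pour_loop h (S (some r)) (Function.update S (some r) (S (some r)).tail) (by simp))
  refine (h1.mono (by omega)).cast ?_
  congr 1
  funext k
  rcases eq_or_ne k (some r') with rfl | h1
  · simp_all [Ne.symm h]
  · rcases eq_or_ne k (some r) with rfl | h2 <;> simp_all

/-- The loop which moves trees from the stack of values to the stack `r`. The counter contains the
number of trees to move. -/
def takeLoop (r : Reg) : Cmd :=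
  .loop Option.isSome (.seq (.pop (some .val)) (.seq (.push r (· = bitBuf true))
    (.seq (.case fun v => if v = bitBuf true then
      .seq (.push .cnt fun _ => true) (.push .cnt fun _ => true) else .load id)
      (.pop (some .cnt)))))

/-- Move a tree from the stack of values to the stack `r`. -/
def take (r : Reg) : Cmd :=
  .seq (.push .cnt fun _ => true) (.seq (.pop (some .cnt)) (takeLoop r))

/-- The bits of a tree are a prefix code: a `true` bit announces two subtrees, a `false` bit
completes a tree, and the counter records how many trees are still owed after the current one. The
hypothesis `h` is the continuation once `t` has been moved and a mark has been popped, which makes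
the induction on `t` compose. Each bit costs a test and at most six steps. -/
theorem runs_takeLoop {r : Reg} (hr : r = .aux ∨ r = .aux') (t : Code) (v a a' c x : List Bool)
    (i : List Sym) (b : Bool) (s : Buf × Stacks) (n : ℕ)
    (h : Runs (takeLoop r) (c.head?.map .inl,
      Function.update (mkStacks v a a' c.tail i) (some r) (t.write.reverse ++ x)) s n) :
    Runs (takeLoop r) (bitBuf b,
      Function.update (mkStacks (t.write ++ v) a a' c i) (some r) x) s (n + 7 * t.size) := by
  induction t generalizing v c x b n with
  | nil =>
    refine (Runs.loop_step (t := 6) rfl ?_ h).mono (by simp; omega)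
    refine Runs.pop_seq _ ?_
    refine Runs.push_seq _ _ ?_
    rcases hr with rfl | rfl
    all_goals
      simp [Code.write, toBuf]
      refine Runs.case_seq ?_
      rw [if_neg (by simp)]
      refine Runs.load_seq (t := 1) _ ?_ |>.mono (by omega)
      exact (Runs.pop (some .cnt) _ _).cast (by simp [toBuf])
  | cons t u ht hu =>
    -- Two marks are pushed for the root bit and one is popped at once for the left subtree. The
    -- other one waits below in the counter, and is popped when the left subtree is complete, to
    -- start the right one.
    have h1 := hu v c (t.write.reverse ++ true :: x) true n (by simpa [Code.write] using h)
    have h2 := ht (u.write ++ v) (true :: c) (true :: x) true _ h1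
    refine (Runs.loop_step (t := 6) rfl ?_ h2).mono (by simp; omega)
    refine Runs.pop_seq _ ?_
    refine Runs.push_seq _ _ ?_
    rcases hr with rfl | rfl
    all_goals
      simp [Code.write, toBuf]
      refine Runs.case_seq ?_
      rw [if_pos rfl]
      refine Runs.seq_assoc (Runs.push_seq _ _ (Runs.push_seq _ _ ?_))
      exact (Runs.pop (some .cnt) _ _).cast (by simp [toBuf])

theorem runs_take {r : Reg} (hr : r = .aux ∨ r = .aux') (t : Code) (v a a' x : List Bool)
    (w : Buf) (i : List Sym) :
    Runs (take r) (w, Function.update (mkStacks (t.write ++ v) a a' [] i) (some r) x)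
      (none, Function.update (mkStacks v a a' [] i) (some r) (t.write.reverse ++ x))
      (7 * t.size + 3) := by
  have h : Runs (takeLoop r) (bitBuf true,
      Function.update (mkStacks (t.write ++ v) a a' [] i) (some r) x) _ (1 + 7 * t.size) :=
    runs_takeLoop hr t v a a' [] x i true
      (none, Function.update (mkStacks v a a' [] i) (some r) (t.write.reverse ++ x)) 1
      (Runs.loop_done rfl)
  refine (Runs.push_seq _ _ (Runs.pop_seq _ (t := 1 + 7 * t.size) ?_)).mono (by omega)
  rcases hr with rfl | rfl <;> simpa [toBuf] using h

/-- Exchange the two topmost trees. -/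
def swap : Cmd := .seq (take .aux) (.seq (take .aux') (.seq (pour .aux .val) (pour .aux' .val)))

/-- Pouring undoes the reversal caused by `take`; since `aux` is emptied first, `t` ends up below
`u`. Each bit costs 7 steps to take and 3 to pour. -/
theorem runs_swap (t u : Code) (v : List Bool) :
    Runs swap (valState (t.write ++ (u.write ++ v))) (valState (u.write ++ (t.write ++ v)))
      (10 * t.size + 10 * u.size + 10) := by
  have h1 := runs_take (.inl rfl) t (u.write ++ v) [] [] [] none []
  have h2 := runs_take (.inr rfl) u v t.write.reverse [] [] none []
  have h3 := runs_pour (show Reg.aux ≠ .val by decide) none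
    (mkStacks v t.write.reverse u.write.reverse [] [])
  have h4 := runs_pour (show Reg.aux' ≠ .val by decide) none
    (mkStacks (t.write ++ v) [] u.write.reverse [] [])
  simp only [update_mkStacks_aux, update_mkStacks_aux', update_mkStacks_val, mkStacks_aux,
    mkStacks_aux', mkStacks_val, List.reverse_reverse, List.append_nil, List.length_reverse]
    at h1 h2 h3 h4
  refine (h1.seq (h2.seq (h3.seq h4))).mono ?_
  simp only [Code.size]
  omega

/-- Erase the topmost tree. -/
def drop : Cmd := .seq (take .aux) (.seq (.pop (some .aux))
    (.loop Option.isSome (.pop (some .aux))))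

theorem runs_drop (t : Code) (v : List Bool) :
    Runs drop (valState (t.write ++ v)) (valState v) (10 * t.size + 10) := by
  have h1 := runs_take (.inl rfl) t v [] [] [] none []
  simp only [update_mkStacks_aux] at h1
  have h2 : ∀ l : List Bool, Runs (.loop Option.isSome (.pop (some .aux)))
      (l.head?.map .inl, mkStacks v l.tail [] [] []) (valState v) (2 * l.length + 1) := by
    intro l
    induction l with
    | nil => exact Runs.loop_done rfl
    | cons b l ih =>
      refine (Runs.loop_step (t := 1) rfl ?_ ih).mono (by simp; omega)
      simpa [toBuf] using Runs.pop (some .aux) (bitBuf b) (mkStacks v l [] [] [])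
  refine (h1.seq (Runs.pop_seq _ (t := 2 * t.size + 1) ?_)).mono (by omega)
  simpa [toBuf, Code.size] using h2 t.write.reverse

/-- Copy the topmost tree. -/
def dup : Cmd :=
  .seq (take .aux) (.seq (.seq (.pop (some .aux)) (.loop Option.isSome
    (.seq (.push .val (· = bitBuf true)) (.seq (.push .aux' (· = bitBuf true))
        (.pop (some .aux))))))
    (.seq (pour .aux' .aux) (pour .aux .val)))

theorem runs_dup (t : Code) (v : List Bool) :
    Runs dup (valState (t.write ++ v)) (valState (t.write ++ (t.write ++ v)))
      (20 * t.size + 20) := by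
  have h1 := runs_take (.inl rfl) t v [] [] [] none []
  have h2 : ∀ l v a' : List Bool, Runs (.loop Option.isSome
      (.seq (.push .val (· = bitBuf true)) (.seq (.push .aux' (· = bitBuf true))
          (.pop (some .aux)))))
      (l.head?.map .inl, mkStacks v l.tail a' [] [])
      (none, mkStacks (l.reverse ++ v) [] (l.reverse ++ a') [] []) (4 * l.length + 1) := by
    intro l
    induction l with
    | nil => exact fun _ _ => Runs.loop_done rfl
    | cons b l ih =>
      intro v a'
      have h := ih (b :: v) (b :: a')
      simp only [List.reverse_cons, List.append_assoc, List.singleton_append]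
      refine (Runs.loop_step (t := 3) rfl ?_ h).mono (by simp; omega)
      refine Runs.push_seq _ _ (Runs.push_seq _ _ ?_)
      have hb : (decide (bitBuf b = bitBuf true)) = b := by cases b <;> rfl
      simpa [toBuf, hb] using Runs.pop (some .aux) (bitBuf b) (mkStacks (b :: v) l (b :: a') [] [])
  have h3 := Runs.pop_seq (some .aux) (v := none) (S := mkStacks v t.write.reverse [] [] [])
    (by simpa [toBuf] using h2 t.write.reverse v [])
  -- The second copy lies on `aux'` in its original orientation, so that it takes two pours, hence
  -- two reversals, to bring it to the stack of values.
  have h4 := runs_pour (show Reg.aux' ≠ .aux by decide) none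
    (mkStacks (t.write ++ v) [] t.write [] [])
  have h5 := runs_pour (show Reg.aux ≠ .val by decide) none
    (mkStacks (t.write ++ v) t.write.reverse [] [] [])
  simp only [update_mkStacks_aux, update_mkStacks_aux', update_mkStacks_val, mkStacks_aux,
    mkStacks_aux', mkStacks_val, List.reverse_reverse, List.append_nil, List.length_reverse]
    at h1 h3 h4 h5
  refine (h1.seq (h3.seq (h4.seq h5))).mono ?_
  simp only [Code.size]
  omega

/-- Write a fixed tree. -/
def const : Code → Cmd
  | .nil => .push .val fun _ => false
  | .cons t u => .seq (const u) (.seq (const t) (.push .val fun _ => true))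

theorem runs_const (t : Code) (w : Buf) (v : List Bool) (i : List Sym) :
    Runs (const t) (w, mkStacks v [] [] [] i) (w, mkStacks (t.write ++ v) [] [] [] i) t.size := by
  induction t generalizing v with
  | nil =>
    exact (Runs.push .val (fun _ => false) w (mkStacks v [] [] [] i)).cast (by simp [Code.write])
  | cons t u ht hu =>
    have h := Runs.push .val (fun _ => true) w (mkStacks (t.write ++ (u.write ++ v)) [] [] [] i)
    simp only [mkStacks_val, update_mkStacks_val] at h
    exact (((hu v).seq ((ht _).seq h)).mono (by simp only [Code.size_cons]; omega)).cast
      (by simp [Code.write])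

end Cmd
end WeightedEpistemic

namespace WeightedEpistemic

open Turing

/-! ### Functions that are computable in polynomial time -/

/-- Coefficients are natural numbers, so evaluation is monotone and a bound on the size of an
argument can be substituted into a running time. -/
theorem eval_le_eval (p : Polynomial ℕ) {m n : ℕ} (h : m ≤ n) : p.eval m ≤ p.eval n := by
  induction p using Polynomial.induction_on' with
  | add p q hp hq => simpa using Nat.add_le_add hp hq
  | monomial k a => simpa using Nat.mul_le_mul_left _ (Nat.pow_le_pow_left h _)

/-- Types whose elements are represented by trees. -/
class Enc (α : Type) where
  toCode : α → Code

open Enc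

/-- The number of bits of the tree that represents `a`. -/
def sz {α : Type} [Enc α] (a : α) : ℕ := (toCode a).size

/-- The function `f` is computable in polynomial time on the trees that represent its arguments and
its values. -/
@[fun_prop]
def PolyTime {α β : Type} [Enc α] [Enc β] (f : α → β) : Prop :=
  ∃ (c : Cmd) (p : Polynomial ℕ), ∀ a, sz (f a) ≤ p.eval (sz a) ∧ ∀ v,
    Runs c (valState ((toCode a).write ++ v)) (valState ((toCode (f a)).write ++ v)) (p.eval (sz a))

/-- In all these encodings `false`, `none`, `[]` and `0` are the empty tree, and the other values
have the trees of pairs: `a :: l` that of `(a, l)`, `some a` that of `(a, ())`, `n + 1` that of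
`((), n)`. So constructors cost nothing and a single branching primitive serves all types. -/
instance : Enc Unit := ⟨fun _ => .nil⟩

instance : Enc Bool := ⟨fun b => cond b (.cons .nil .nil) .nil⟩

instance {α β : Type} [Enc α] [Enc β] : Enc (α × β) := ⟨fun x => .cons (toCode x.1) (toCode x.2)⟩

instance {α : Type} [Enc α] : Enc (Option α) :=
  ⟨fun x => x.elim .nil fun a => .cons (toCode a) .nil⟩

instance {α : Type} [Enc α] : Enc (List α) :=
  ⟨fun l => l.foldr (fun a t => .cons (toCode a) t) .nil⟩

instance : Enc ℕ := ⟨fun n => n.rec .nil fun _ t => .cons .nil t⟩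

section

variable {α β γ δ : Type} [Enc α] [Enc β] [Enc γ] [Enc δ]

theorem toCode_pair (x : α × β) : toCode x = .cons (toCode x.1) (toCode x.2) := rfl
theorem toCode_cons (a : α) (l : List α) : toCode (a :: l) = .cons (toCode a) (toCode l) := rfl

@[simp] theorem sz_pair (x : α × β) : sz x = 1 + sz x.1 + sz x.2 := by simp [sz, toCode_pair]
@[simp] theorem sz_nil : sz ([] : List α) = 1 := rfl
@[simp] theorem sz_cons (a : α) (l : List α) : sz (a :: l) = 1 + sz a + sz l := by
  simp [sz, toCode_cons]
@[simp] theorem sz_none : sz (none : Option α) = 1 := rfl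
@[simp] theorem sz_some (a : α) : sz (some a) = 2 + sz a := by
  simp [sz, toCode]; omega
@[simp] theorem sz_zero : sz 0 = 1 := rfl
@[simp] theorem sz_succ (n : ℕ) : sz (n + 1) = 2 + sz n := by
  simp [sz, toCode]
theorem sz_bool_le (b : Bool) : sz b ≤ 3 := by cases b <;> simp [sz, toCode]

theorem sz_pos (a : α) : 1 ≤ sz a := by
  unfold sz
  cases toCode a <;> simp [add_assoc]

theorem length_le_sz (l : List α) : l.length ≤ sz l := by
  induction l with
  | nil => simp
  | cons a l ih => simp; omega

theorem sz_le_of_mem {a : α} {l : List α} (h : a ∈ l) : sz a ≤ sz l := by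
  induction l with
  | nil => simp at h
  | cons b l ih =>
    simp only [sz_cons]
    rcases List.mem_cons.1 h with rfl | h
    · omega
    · have := ih h; omega

namespace PolyTime

@[fun_prop]
theorem id : PolyTime (fun a : α => a) :=
  ⟨.load fun v => v, .X + 1, fun a => ⟨by simp, fun v => (Runs.load _ _ _).mono (by simp)⟩⟩

/-- The trees coincide, so a program that does nothing computes `f`. This covers the constructors of
lists and optional values. -/
theorem of_toCode_eq {f : α → β} (h : ∀ a, toCode (f a) = toCode a) : PolyTime f := by
  refine ⟨.load fun v => v, .X + 1, fun a => ⟨by simp [sz, h], fun v => ?_⟩⟩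
  rw [h]
  exact (Runs.load _ _ _).mono (by simp)

@[fun_prop]
theorem const (b : β) : PolyTime (fun _ : α => b) := by
  refine ⟨.seq Cmd.drop (.const (toCode b)), 10 * .X + 10 + Polynomial.C (sz b), fun a =>
    ⟨by simp, fun v => ?_⟩⟩
  refine ((Cmd.runs_drop _ v).seq (Cmd.runs_const _ _ _ _)).mono ?_
  simp [sz]

-- The bound on the size of the value in `PolyTime` is what is needed here: the running time of `g`
-- is polynomial in `sz (f a)`, hence in `sz a`.
@[fun_prop]
theorem comp {g : β → γ} {f : α → β} (hg : PolyTime g) (hf : PolyTime f) :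
    PolyTime (fun a => g (f a)) := by
  obtain ⟨c, p, hc⟩ := hf
  obtain ⟨d, q, hd⟩ := hg
  refine ⟨.seq c d, p + q.comp p, fun a => ?_⟩
  obtain ⟨h1, h2⟩ := hc a
  obtain ⟨h3, h4⟩ := hd (f a)
  have h5 := eval_le_eval q h1
  simp only [Polynomial.eval_add, Polynomial.eval_comp]
  exact ⟨by omega, fun v => ((h2 v).seq (h4 v)).mono (by omega)⟩

-- The arbitrary rest `v` of the stack in `PolyTime` is used here: `f` runs above a spare copy of
-- the argument, and `g` above the value of `f`.
@[fun_prop]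
theorem prodMk {f : α → β} {g : α → γ} (hf : PolyTime f) (hg : PolyTime g) :
    PolyTime (fun a => (f a, g a)) := by
  obtain ⟨c, p, hc⟩ := hf
  obtain ⟨d, q, hd⟩ := hg
  refine ⟨.seq Cmd.dup (.seq c (.seq Cmd.swap (.seq d (.seq Cmd.swap (.push .val fun _ => true))))),
    100 * (.X + p + q + 1), fun a => ?_⟩
  obtain ⟨h1, h2⟩ := hc a
  obtain ⟨h3, h4⟩ := hd a
  simp only [Polynomial.eval_add, Polynomial.eval_mul, Polynomial.eval_X, Polynomial.eval_one,
    Polynomial.eval_ofNat]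
  refine ⟨by simp; omega, fun v => ?_⟩
  have h := (Cmd.runs_dup (toCode a) v).seq ((h2 _).seq ((Cmd.runs_swap _ _ _).seq ((h4 _).seq
    ((Cmd.runs_swap _ _ _).seq (Runs.push .val (fun _ => true) _ _)))))
  refine (h.mono ?_).cast ?_
  · simp only [← sz.eq_1]
    omega
  · simp [valState, toCode_pair, Code.write]

@[fun_prop]
theorem fst : PolyTime (Prod.fst : α × β → α) := by
  refine ⟨.seq (.pop (some .val)) (.seq (.load fun _ => none) (.seq Cmd.swap Cmd.drop)),
    100 * (.X + 1), fun a => ?_⟩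
  simp only [Polynomial.eval_add, Polynomial.eval_mul, Polynomial.eval_X, Polynomial.eval_one,
    Polynomial.eval_ofNat]
  refine ⟨by simp; omega, fun v => ?_⟩
  have h := (Cmd.runs_swap (toCode a.1) (toCode a.2) v).seq (Cmd.runs_drop _ _)
  refine (Runs.pop_seq _ (Runs.load_seq _ (t := 10 * sz a.1 + 10 * sz a.2 + 10 + (10 * sz a.2 + 10))
      ?_)).mono ?_
  · simpa [toCode_pair, Code.write, valState, sz] using h
  · simp only [sz_pair]
    omega

@[fun_prop]
theorem snd : PolyTime (Prod.snd : α × β → β) := by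
  refine ⟨.seq (.pop (some .val)) (.seq (.load fun _ => none) Cmd.drop),
    100 * (.X + 1), fun a => ?_⟩
  simp only [Polynomial.eval_add, Polynomial.eval_mul, Polynomial.eval_X, Polynomial.eval_one,
    Polynomial.eval_ofNat]
  refine ⟨by simp; omega, fun v => ?_⟩
  have h := Cmd.runs_drop (toCode a.1) ((toCode a.2).write ++ v)
  refine (Runs.pop_seq _ (Runs.load_seq _ (t := 10 * sz a.1 + 10) ?_)).mono ?_
  · simpa [toCode_pair, Code.write, valState, sz] using h
  · simp only [sz_pair]
    omega

/-- Case distinction on whether the value of `c` is represented by the empty tree. -/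
theorem ite_nil {c : α → γ} {f : α → β} {g : δ → β} {r : α → β} (hc : PolyTime c) (hf : PolyTime f)
    (hg : PolyTime g) (h : ∀ a, (toCode (c a) = .nil ∧ r a = f a) ∨
      ∃ d t u, toCode (c a) = .cons t u ∧ toCode d = .cons (toCode a) (toCode (c a)) ∧ r a = g d) :
    PolyTime r := by
  obtain ⟨c', pc, hc⟩ := hc
  obtain ⟨f', pf, hf⟩ := hf
  obtain ⟨g', pg, hg⟩ := hg
  -- The popped root bit of `c a` decides. A `false` bit was the whole tree, and `a` is left for
  -- `f`. Otherwise the bit is put back, and a swap and a new root bit assemble the pair of `a` and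
  -- `c a` for `g`, whose size is at most `1 + .X + pc`.
  refine ⟨.seq Cmd.dup (.seq c' (.seq (.pop (some .val)) (.case fun v => .seq (.load fun _ => none)
      (if v = bitBuf false then f' else
        .seq (.push .val fun _ => true) (.seq Cmd.swap (.seq (.push .val fun _ => true) g')))))),
    100 * (.X + pc + pf + 1) + pg.comp (1 + .X + pc), fun a => ?_⟩
  simp only [Polynomial.eval_add, Polynomial.eval_mul, Polynomial.eval_X, Polynomial.eval_one,
    Polynomial.eval_ofNat, Polynomial.eval_comp]
  obtain ⟨h1, h2⟩ := hc a
  rcases h a with ⟨hn, hr⟩ | ⟨d, t, u, hn, hd, hr⟩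
  · obtain ⟨h3, h4⟩ := hf a
    rw [hr]
    refine ⟨by omega, fun v => ?_⟩
    have h5 := Runs.pop_seq (some .val) (v := none) (S := mkStacks
      ((toCode (c a)).write ++ ((toCode a).write ++ v)) [] [] [] [])
      (d := .case fun v => .seq (.load fun _ => none)
      (if v = bitBuf false then f' else
        .seq (.push .val fun _ => true) (.seq Cmd.swap (.seq (.push .val fun _ => true) g'))))
      (t := pf.eval (sz a) + 2) (s := valState ((toCode (f a)).write ++ v)) (by
        refine (Runs.case (Runs.load_seq _ (t := pf.eval (sz a)) ?_)).mono (by omega)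
        rw [if_pos (by simp [hn, Code.write, toBuf])]
        simpa [hn, Code.write, valState] using h4 v)
    refine ((Cmd.runs_dup (toCode a) v).seq ((h2 _).seq h5)).mono ?_
    simp only [← sz.eq_1]
    omega
  · obtain ⟨h3, h4⟩ := hg d
    have hs : sz d = 1 + sz a + sz (c a) := by simp [sz, hd]
    have h6 := eval_le_eval pg (show sz d ≤ 1 + sz a + pc.eval (sz a) by omega)
    rw [hr]
    refine ⟨by omega, fun v => ?_⟩
    have h7 := h4 v
    rw [hd] at h7
    have h5 := Runs.pop_seq (some .val) (v := none) (S := mkStacks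
      ((toCode (c a)).write ++ ((toCode a).write ++ v)) [] [] [] [])
      (d := .case fun v => .seq (.load fun _ => none)
      (if v = bitBuf false then f' else
        .seq (.push .val fun _ => true) (.seq Cmd.swap (.seq (.push .val fun _ => true) g'))))
      (t := pg.eval (sz d) + (10 * sz a + 10 * sz (c a) + 10) + 4)
      (s := valState ((toCode (g d)).write ++ v)) (by
        refine (Runs.case (Runs.load_seq _ (t := pg.eval (sz d) +
          (10 * sz a + 10 * sz (c a) + 10) + 2) ?_)).mono (by omega)
        rw [if_neg (by simp [hn, Code.write, toBuf])]
        have h8 := (Cmd.runs_swap (toCode (c a)) (toCode a) v).seq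
            (Runs.push_seq .val (fun _ => true)
          (d := g') (t := pg.eval (sz d)) (by simpa [Code.write, valState] using h7))
        refine Runs.push_seq _ _ (h8.mono (by simp only [sz]; omega) |>.of_eq ?_)
        simp [hn, Code.write, valState])
    refine ((Cmd.runs_dup (toCode a) v).seq ((h2 _).seq h5)).mono ?_
    simp only [← sz.eq_1]
    omega

/-- Bounded iteration. -/
theorem iterate {n : δ → List γ} {i : δ → α} {f : α → α} (hn : PolyTime n) (hi : PolyTime i)
    (hf : PolyTime f)
    (q : Polynomial ℕ) (hq : ∀ d, ∀ k ≤ (n d).length, sz (f^[k] (i d)) ≤ q.eval (sz d)) :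
    PolyTime (fun d => f^[(n d).length] (i d)) := by
  obtain ⟨c, p, hc⟩ := prodMk hn hi
  obtain ⟨f', pf, hf⟩ := hf
  -- The list serves as a clock, and its root bit has been popped before each round. The body erases
  -- the first element, applies `f` to the value below the remaining list, and pops the next root
  -- bit.
  let body : Cmd := .seq (.load fun _ => none) (.seq Cmd.drop (.seq Cmd.swap (.seq f'
    (.seq Cmd.swap (.pop (some .val))))))
  -- Here `B` bounds all iterates and `B'` the list. Both stay fixed in the induction, so every
  -- round has the same cost bound.
  have loop : ∀ (l : List γ) (x : α) (B B' : ℕ), (∀ k ≤ l.length, sz (f^[k] x) ≤ B) → sz l ≤ B' →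
      ∀ v, Runs (.loop (· = bitBuf true) body)
        ((toCode l).write.head?.map .inl, mkStacks ((toCode l).write.tail ++
            ((toCode x).write ++ v))
          [] [] [] [])
        (bitBuf false, mkStacks ((toCode (f^[l.length] x)).write ++ v) [] [] [] [])
        (l.length * (100 * (B + B' + pf.eval B + 1)) + 1) := by
    intro l
    induction l with
    | nil => exact fun x B B' _ _ v => (Runs.loop_done (by rfl)).mono (by omega)
    | cons y l ih =>
      intro x B B' hB hB' v
      simp only [sz_cons] at hB'
      have h1 := ih (f x) B B' (fun k hk => hB (k + 1) (by simpa using hk)) (by omega) v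
      refine (Runs.loop_step (t := 99 * (B + B' + pf.eval B + 1)) rfl ?_ h1).mono ?_
      · have h2 := Cmd.runs_drop (toCode y) ((toCode l).write ++ ((toCode x).write ++ v))
        have h3 := Cmd.runs_swap (toCode l) (toCode x) v
        have h4 := (hf x).2 ((toCode l).write ++ v)
        have h5 := Cmd.runs_swap (toCode (f x)) (toCode l) v
        have h6 := h2.seq (h3.seq (h4.seq (h5.seq (Runs.pop (some .val) _ _))))
        have h7 := hB 0 (by simp)
        have h8 := hB 1 (by simp)
        have h9 := eval_le_eval pf h7
        simp only [Function.iterate_zero, Function.iterate_one, id_eq] at h7 h8 h9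
        simp only [← sz.eq_1] at h6
        refine (Runs.load_seq _ (h6.of_eq ?_)).mono ?_ |>.cast ?_
        · simp [toCode_cons, valState, Code.write]
        · omega
        · have hne : (toCode l).write ≠ [] := by cases toCode l <;> simp [Code.write]
          obtain ⟨b, w, hw⟩ := List.exists_cons_of_ne_nil hne
          simp [toBuf, hw]
      · simp only [List.length_cons]
        ring_nf
        omega
  -- The first pop removes the root bit of the pair of `n d` and `i d`, the second the root bit of
  -- the list, on which the loop starts. The last load restores the empty buffer.
  refine ⟨.seq c (.seq (.pop (some .val)) (.seq (.load fun _ => none) (.seq (.pop (some .val))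
    (.seq (.loop (· = bitBuf true) body) (.load fun _ => none))))),
    p + p * (100 * (q + p + pf.comp q + 1)) + q + 5, fun d => ?_⟩
  simp only [Polynomial.eval_add, Polynomial.eval_mul, Polynomial.eval_one,
    Polynomial.eval_ofNat, Polynomial.eval_comp]
  refine ⟨(hq d _ le_rfl).trans (by omega), fun v => ?_⟩
  obtain ⟨h1, h2⟩ := hc d
  simp only [sz_pair] at h1
  have h3 := (loop (n d) (i d) (q.eval (sz d)) (p.eval (sz d)) (hq d) (by omega) v).seq
    (Runs.load (fun _ => none) _ _)
  have h4 : (n d).length ≤ p.eval (sz d) := (length_le_sz _).trans (by omega)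
  have h5 := Nat.mul_le_mul_right
    (100 * (q.eval (sz d) + p.eval (sz d) + pf.eval (q.eval (sz d)) + 1)) h4
  refine ((h2 v).seq (Runs.pop_seq _ (Runs.load_seq _ (Runs.pop_seq _ (h3.of_eq ?_))))).mono ?_
  · have hne : (toCode (n d)).write ≠ [] := by cases toCode (n d) <;> simp [Code.write]
    obtain ⟨b, w, hw⟩ := List.exists_cons_of_ne_nil hne
    simp [toBuf, hw, toCode_pair, Code.write]
  · omega

end PolyTime
end
end WeightedEpistemic

/-! ### Closure properties: Boolean operations, optional values, folds over lists, finite case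
distinctions -/

namespace WeightedEpistemic

open Enc

section

variable {α β γ δ : Type} [Enc α] [Enc β] [Enc γ] [Enc δ]

theorem sz_drop_le (l : List α) (k : ℕ) : sz (l.drop k) ≤ sz l := by
  induction l generalizing k with
  | nil => simp
  | cons a l ih =>
    cases k with
    | zero => simp
    | succ k => have := ih k; simp; omega

theorem PolyTime.exists_bound {f : α → β} (hf : PolyTime f) :
    ∃ p : Polynomial ℕ, ∀ a, sz (f a) ≤ p.eval (sz a) := by
  obtain ⟨_, p, h⟩ := hf
  exact ⟨p, fun a => (h a).1⟩

namespace PolyTime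

@[fun_prop]
theorem cond {c : α → Bool} {f g : α → β} (hc : PolyTime c) (hf : PolyTime f) (hg : PolyTime g) :
    PolyTime (fun a => bif c a then f a else g a) :=
  ite_nil (g := fun x : α × Bool => f x.1) hc hg (hf.comp fst) fun a => by
    cases h : c a
    · exact .inl ⟨rfl, rfl⟩
    · exact .inr ⟨(a, true), _, _, rfl, rfl, rfl⟩

@[fun_prop]
theorem not {f : α → Bool} (hf : PolyTime f) : PolyTime (fun a => !f a) := by
  have : PolyTime (fun a => bif f a then false else true) := by fun_prop
  convert this using 2 with a
  cases f a <;> rfl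

@[fun_prop]
theorem and {f g : α → Bool} (hf : PolyTime f) (hg : PolyTime g) :
    PolyTime (fun a => f a && g a) := by
  have : PolyTime (fun a => bif f a then g a else false) := by fun_prop
  convert this using 2 with a
  cases f a <;> rfl

@[fun_prop]
theorem or {f g : α → Bool} (hf : PolyTime f) (hg : PolyTime g) :
    PolyTime (fun a => f a || g a) := by
  have : PolyTime (fun a => bif f a then true else g a) := by fun_prop
  convert this using 2 with a
  cases f a <;> rfl

@[fun_prop]
theorem beq_bool {f g : α → Bool} (hf : PolyTime f) (hg : PolyTime g) :
    PolyTime (fun a => f a == g a) := by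
  have : PolyTime (fun a => bif f a then g a else !g a) := by fun_prop
  convert this using 2 with a
  cases f a <;> cases g a <;> rfl

/-- Case distinction on whether a list is empty. -/
theorem list_cases {l : α → List β} {f : α → γ} {g : α × β × List β → γ} {r : α → γ}
    (hl : PolyTime l)
    (hf : PolyTime f) (hg : PolyTime g) (h : ∀ a, l a = [] → r a = f a)
    (h' : ∀ a b t, l a = b :: t → r a = g (a, b, t)) : PolyTime r :=
  ite_nil hl hf hg fun a => by
    rcases hla : l a with _ | ⟨b, t⟩
    · exact .inl ⟨rfl, h a hla⟩
    · exact .inr ⟨(a, b, t), _, _, rfl, rfl, h' a b t hla⟩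

/-- Case distinction on an optional value. -/
theorem option_cases {o : α → Option β} {f : α → γ} {g : α × β → γ} {r : α → γ} (ho : PolyTime o)
    (hf : PolyTime f) (hg : PolyTime g) (h : ∀ a, o a = none → r a = f a)
    (h' : ∀ a b, o a = some b → r a = g (a, b)) : PolyTime r :=
  ite_nil (g := fun x : α × β × Unit => g (x.1, x.2.1)) ho hf (by fun_prop) fun a => by
    rcases hoa : o a with _ | b
    · exact .inl ⟨rfl, h a hoa⟩
    · exact .inr ⟨(a, b, ()), _, _, rfl, rfl, h' a b hoa⟩

/-- Case distinction on a natural number. -/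
theorem nat_cases {n : α → ℕ} {f : α → γ} {g : α × ℕ → γ} {r : α → γ} (hn : PolyTime n)
    (hf : PolyTime f) (hg : PolyTime g) (h : ∀ a, n a = 0 → r a = f a)
    (h' : ∀ a m, n a = m + 1 → r a = g (a, m)) : PolyTime r :=
  ite_nil (g := fun x : α × Unit × ℕ => g (x.1, x.2.2)) hn hf (by fun_prop) fun a => by
    rcases hna : n a with _ | m
    · exact .inl ⟨rfl, h a hna⟩
    · exact .inr ⟨(a, (), m), _, _, rfl, rfl, h' a m hna⟩

@[fun_prop]
theorem cons {f : α → β} {g : α → List β} (hf : PolyTime f) (hg : PolyTime g) :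
    PolyTime (fun a => f a :: g a) :=
  (of_toCode_eq (f := fun x : β × List β => x.1 :: x.2) fun _ => rfl).comp (hf.prodMk hg)

@[fun_prop]
theorem some {f : α → β} (hf : PolyTime f) : PolyTime (fun a => Option.some (f a)) :=
  (of_toCode_eq (f := fun x : β × Unit => Option.some x.1) fun _ => rfl).comp
    (hf.prodMk (.const ()))

@[fun_prop]
theorem bind {o : α → Option β} {f : α → β → Option γ} (ho : PolyTime o)
    (hf : PolyTime (fun x : α × β => f x.1 x.2)) : PolyTime (fun a => (o a).bind (f a)) :=
  option_cases ho (const none) hf (fun a h => by simp [h]) (fun a b h => by simp [h])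

@[fun_prop]
theorem map_option {o : α → Option β} {f : α → β → γ} (ho : PolyTime o)
    (hf : PolyTime (fun x : α × β => f x.1 x.2)) : PolyTime (fun a => (o a).map (f a)) :=
  option_cases ho (const none) (some hf) (fun a h => by simp [h]) (fun a b h => by simp [h])

@[fun_prop]
theorem elim {o : α → Option β} {g : α → γ} {f : α → β → γ} (ho : PolyTime o) (hg : PolyTime g)
    (hf : PolyTime (fun x : α × β => f x.1 x.2)) : PolyTime (fun a => (o a).elim (g a) (f a)) :=
  option_cases ho hg hf (fun a h => by simp [h]) (fun a b h => by simp [h])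

@[fun_prop]
theorem head? {f : α → List β} (hf : PolyTime f) : PolyTime (fun a => (f a).head?) :=
  list_cases hf (const none) (g := fun x => Option.some x.2.1) (by fun_prop)
    (fun a h => by simp [h]) (fun a b t h => by simp [h])

@[fun_prop]
theorem tail {f : α → List β} (hf : PolyTime f) : PolyTime (fun a => (f a).tail) :=
  list_cases hf (const []) (g := fun x => x.2.2) (by fun_prop)
    (fun a h => by simp [h]) (fun a b t h => by simp [h])

@[fun_prop]
theorem isEmpty {f : α → List β} (hf : PolyTime f) : PolyTime (fun a => (f a).isEmpty) :=
  list_cases hf (const true) (g := fun _ => false) (by fun_prop)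
    (fun a h => by simp [h]) (fun a b t h => by simp [h])

/-- A fold is an iteration on triples of parameter, accumulator and remaining list. The accumulator
must be bounded after every prefix, since a polynomial-time step alone could double it each time. -/
theorem foldl {l : α → List β} {i : α → γ} {f : α → γ → β → γ} (hl : PolyTime l) (hi : PolyTime i)
    (hf : PolyTime (fun x : α × γ × β => f x.1 x.2.1 x.2.2)) (p : Polynomial ℕ)
    (hp : ∀ a k, sz (((l a).take k).foldl (f a) (i a)) ≤ p.eval (sz a)) :
    PolyTime (fun a => (l a).foldl (f a) (i a)) := by
  obtain ⟨q, hq⟩ := hl.exists_bound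
  let step : α × γ × List β → α × γ × List β := fun x =>
    (x.1, x.2.2.head?.elim x.2.1 (fun b => f x.1 x.2.1 b), x.2.2.tail)
  have hf' : PolyTime (fun x : (α × γ × List β) × β => f x.1.1 x.1.2.1 x.2) :=
    hf.comp (f := fun x : (α × γ × List β) × β => (x.1.1, x.1.2.1, x.2)) (by fun_prop)
  have hstep : PolyTime step := by
    have : PolyTime (fun x : α × γ × List β => x.2.2.head?.elim x.2.1 (fun b => f x.1 x.2.1 b)) :=
      elim (by fun_prop) (by fun_prop) hf'
    fun_prop
  have key : ∀ (a : α) (k : ℕ) (s : γ) (m : List β),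
      step^[k] (a, s, m) = (a, (m.take k).foldl (f a) s, m.drop k) := by
    intro a k
    induction k with
    | zero => simp
    | succ k ih =>
      intro s m
      rw [Function.iterate_succ_apply]
      rcases m with _ | ⟨b, m⟩
      · exact (ih _ _).trans (by simp)
      · exact (ih _ _).trans (by simp)
  have := (iterate (f := step) (i := fun a => (a, i a, l a)) hl (by fun_prop) hstep
    (2 + .X + p + q) fun a k _ => by
      have h1 := hp a k
      have h2 := (sz_drop_le (l a) k).trans (hq a)
      simp only [key, sz_pair, Polynomial.eval_add, Polynomial.eval_X, Polynomial.eval_ofNat]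
      omega)
  have h2 : PolyTime (fun a => (step^[(l a).length] (a, i a, l a)).2.1) := by fun_prop
  simpa [key] using h2

/-- If a step adds at most an amount that depends only on the parameter, the total growth is at most
the length of the list times this amount. Most folds below are of this kind. -/
theorem foldl_of_le {l : α → List β} {i : α → γ} {f : α → γ → β → γ} (hl : PolyTime l)
    (hi : PolyTime i)
    (hf : PolyTime (fun x : α × γ × β => f x.1 x.2.1 x.2.2)) (p : Polynomial ℕ)
    (hp : ∀ a s, ∀ b ∈ l a, sz (f a s b) ≤ sz s + p.eval (sz a)) :
    PolyTime (fun a => (l a).foldl (f a) (i a)) := by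
  obtain ⟨q, hq⟩ := hl.exists_bound
  obtain ⟨r, hr⟩ := hi.exists_bound
  refine foldl hl hi hf (r + q * p) fun a k => ?_
  have key : ∀ (m : List β) (s : γ), (∀ b ∈ m, b ∈ l a) →
      sz (m.foldl (f a) s) ≤ sz s + m.length * p.eval (sz a) := by
    intro m
    induction m with
    | nil => simp
    | cons b m ih =>
      intro s hm
      have h1 := ih (f a s b) fun b hb => hm b (by simp [hb])
      have h2 := hp a s b (hm b (by simp))
      simp only [List.foldl_cons, List.length_cons, add_mul]
      omega
  refine (key _ _ fun b hb => List.mem_of_mem_take hb).trans ?_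
  have h1 : ((l a).take k).length ≤ q.eval (sz a) :=
    (List.length_take_le' _ _).trans ((length_le_sz _).trans (hq a))
  have h2 := Nat.mul_le_mul_right (p.eval (sz a)) h1
  have h3 := hr a
  simp only [Polynomial.eval_add, Polynomial.eval_mul]
  omega

@[fun_prop]
theorem reverse {l : α → List β} (hl : PolyTime l) : PolyTime (fun a => (l a).reverse) := by
  obtain ⟨q, hq⟩ := hl.exists_bound
  have := foldl_of_le (f := fun _ s b => b :: s) (i := fun _ => []) hl (by fun_prop) (by fun_prop)
    (1 + q) fun a s b hb => by
      have := (sz_le_of_mem hb).trans (hq a)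
      simp
      omega
  simpa using this

theorem foldr_of_le {l : α → List β} {i : α → γ} {f : α → β → γ → γ} (hl : PolyTime l)
    (hi : PolyTime i)
    (hf : PolyTime (fun x : α × β × γ => f x.1 x.2.1 x.2.2)) (p : Polynomial ℕ)
    (hp : ∀ a s, ∀ b ∈ l a, sz (f a b s) ≤ sz s + p.eval (sz a)) :
    PolyTime (fun a => (l a).foldr (f a) (i a)) := by
  have := foldl_of_le (f := fun a s b => f a b s) hl.reverse hi
    (hf.comp (f := fun x : α × γ × β => (x.1, x.2.2, x.2.1)) (by fun_prop)) p
    (fun a s b hb => hp a s b (by simpa using hb))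
  simpa using this

theorem exists_bound_mem {l : α → List β} {f : α → β → γ} (hl : PolyTime l)
    (hf : PolyTime (fun x : α × β => f x.1 x.2)) :
    ∃ p : Polynomial ℕ, ∀ a, ∀ b ∈ l a, sz (f a b) ≤ p.eval (sz a) := by
  obtain ⟨p, hp⟩ := hf.exists_bound
  obtain ⟨q, hq⟩ := hl.exists_bound
  refine ⟨p.comp (1 + .X + q), fun a b hb => (hp (a, b)).trans ?_⟩
  rw [Polynomial.eval_comp]
  refine eval_le_eval p ?_
  have := (sz_le_of_mem hb).trans (hq a)
  simp
  omega

@[fun_prop]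
theorem filter {l : α → List β} {f : α → β → Bool} (hl : PolyTime l)
    (hf : PolyTime (fun x : α × β => f x.1 x.2)) : PolyTime (fun a => (l a).filter (f a)) := by
  obtain ⟨p, hp⟩ := exists_bound_mem (f := fun a b => b) hl (by fun_prop)
  have := foldr_of_le (f := fun a b (s : List β) => bif f a b then b :: s else s) (i := fun _ => [])
    hl (by fun_prop)
    (cond (hf.comp (f := fun x : α × β × List β => (x.1, x.2.1)) (by fun_prop)) (by fun_prop)
      (by fun_prop))
    (1 + p) fun a s b hb => by
      have := hp a b hb
      cases f a b <;> simp
      omega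
  convert this using 2 with a
  induction l a with
  | nil => rfl
  | cons b m ih => cases h : f a b <;> simp [h, ih]

@[fun_prop]
theorem all {l : α → List β} {f : α → β → Bool} (hl : PolyTime l)
    (hf : PolyTime (fun x : α × β => f x.1 x.2)) : PolyTime (fun a => (l a).all (f a)) := by
  have := foldr_of_le (f := fun a b (s : Bool) => f a b && s) (i := fun _ => true)
    hl (by fun_prop)
    (and (hf.comp (f := fun x : α × β × Bool => (x.1, x.2.1)) (by fun_prop)) (by fun_prop))
    3 fun a s b hb => by
      have := sz_bool_le (f a b && s)
      simp
      omega
  convert this using 2 with a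
  induction l a <;> simp_all

@[fun_prop]
theorem any {l : α → List β} {f : α → β → Bool} (hl : PolyTime l)
    (hf : PolyTime (fun x : α × β => f x.1 x.2)) : PolyTime (fun a => (l a).any (f a)) := by
  have := foldr_of_le (f := fun a b (s : Bool) => f a b || s) (i := fun _ => false)
    hl (by fun_prop)
    (or (hf.comp (f := fun x : α × β × Bool => (x.1, x.2.1)) (by fun_prop)) (by fun_prop))
    3 fun a s b hb => by
      have := sz_bool_le (f a b || s)
      simp
      omega
  convert this using 2 with a
  induction l a <;> simp_all

@[fun_prop]
theorem append {f g : α → List β} (hf : PolyTime f) (hg : PolyTime g) :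
    PolyTime (fun a => f a ++ g a) := by
  obtain ⟨p, hp⟩ := exists_bound_mem (f := fun a b => b) hf (by fun_prop)
  have := foldr_of_le (f := fun a b (s : List β) => b :: s) hf hg (by fun_prop)
    (1 + p) fun a s b hb => by
      have := hp a b hb
      simp
      omega
  simpa using this

@[fun_prop]
theorem flatMap {l : α → List β} {f : α → β → List γ} (hl : PolyTime l)
    (hf : PolyTime (fun x : α × β => f x.1 x.2)) : PolyTime (fun a => (l a).flatMap (f a)) := by
  obtain ⟨p, hp⟩ := exists_bound_mem hl hf
  have happ : ∀ x y : List γ, sz (x ++ y) ≤ sz x + sz y := by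
    intro x y
    induction x with
    | nil => simp
    | cons a x ih => simp; omega
  have := foldr_of_le (f := fun a b (s : List γ) => f a b ++ s) (i := fun _ => []) hl (by fun_prop)
    (append (hf.comp (f := fun x : α × β × List γ => (x.1, x.2.1)) (by fun_prop)) (by fun_prop))
    p fun a s b hb => by
      have := hp a b hb
      have := happ (f a b) s
      omega
  convert this using 2 with a
  induction l a <;> simp_all

@[fun_prop]
theorem headD {f : α → List β} {g : α → β} (hf : PolyTime f) (hg : PolyTime g) :
    PolyTime (fun a => (f a).headD (g a)) :=
  list_cases hf hg (g := fun x => x.2.1) (by fun_prop)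
    (fun a h => by simp [h]) (fun a b t h => by simp [h])

/-- Look-up in a finite table, peeling off the number one unit at a time. The cut-off at `N` gives
every larger number the last entry, so after `N` units the value no longer depends on the number. -/
theorem of_nat_le (N : ℕ) {g : ℕ → α → β} (hg : ∀ n, PolyTime (g n)) :
    PolyTime (fun x : ℕ × α => g (min x.1 N) x.2) := by
  induction N generalizing g with
  | zero => simpa using (hg 0).comp snd
  | succ N ih =>
    refine nat_cases (n := fun x => x.1) (f := fun x => g 0 x.2) (by fun_prop)
      ((hg 0).comp (f := fun x : ℕ × α => x.2) snd) (g := fun x => g (min x.2 N + 1) x.1.2)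
      ((ih fun n => hg (n + 1)).comp (f := fun x : (ℕ × α) × ℕ => (x.2, x.1.2)) (by fun_prop)) ?_ ?_
    · rintro ⟨_, a⟩ rfl
      simp
    · rintro ⟨_, a⟩ m rfl
      simp

end PolyTime

/-- The symbols are represented by numbers. -/
noncomputable instance : Enc Sym := ⟨fun s => toCode (Fintype.equivFin Sym s : ℕ)⟩

/-- Case distinction on a symbol. -/
theorem PolyTime.sym_cases {s : α → Sym} {f : Sym → α → β} (hs : PolyTime s)
    (hf : ∀ s, PolyTime (f s)) :
    PolyTime (fun a => f (s a) a) := by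
  have h1 : PolyTime (fun s : Sym => (Fintype.equivFin Sym s : ℕ)) := of_toCode_eq fun _ => rfl
  -- The entry `f .ket` is a filler for numbers that are not the index of a symbol; it is never
  -- reached.
  have h2 := (of_nat_le (Fintype.card Sym) (g := fun n =>
    if h : n < Fintype.card Sym then f ((Fintype.equivFin Sym).symm ⟨n, h⟩) else f .ket)
    fun n => by split <;> exact hf _).comp
        (f := fun a : α => (((Fintype.equivFin Sym (s a)) : ℕ), a))
    ((h1.comp hs).prodMk .id)
  convert h2 using 2 with a
  simp [(Fintype.equivFin Sym (s a)).2.le]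

@[fun_prop]
theorem PolyTime.beq_sym {s : α → Sym} (t : Sym) (hs : PolyTime s) :
    PolyTime (fun a => decide (s a = t)) :=
  PolyTime.sym_cases (f := fun s _ => decide (s = t)) hs fun _ => PolyTime.const _

@[fun_prop]
theorem PolyTime.decide_eq_name {f g : α → Name} (hf : PolyTime f) (hg : PolyTime g) :
    PolyTime (fun a => decide (f a = g a)) := by
  -- The fold over one name eats the other one and records whether all letters agreed so far. The
  -- names are equal if they agreed throughout and nothing is left.
  let step : List Bool × Bool → Bool → List Bool × Bool := fun s b =>
    (s.1.tail, s.2 && s.1.head?.elim false (fun c => c == b))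
  have key : ∀ (x y : Name) (b : Bool),
      (((x.foldl step (y, b)).2 && (x.foldl step (y, b)).1.isEmpty)
      = (b && decide (x = y))) := by
    intro x
    induction x with
    | nil => intro y b; cases y <;> simp
    | cons c x ih =>
      intro y b
      rw [List.foldl_cons, ih]
      rcases y with _ | ⟨d, y⟩
      · simp
      · rw [Bool.eq_iff_iff]
        cases b <;> cases c <;> cases d <;> simp
        all_goals exact decide_eq_true_iff
  have h : PolyTime (fun a => (f a).foldl step (g a, true)) :=
    foldl_of_le (f := fun _ => step) hf (by fun_prop) (by fun_prop) 3 fun a s b _ => by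
      have h1 := sz_drop_le s.1 1
      have h2 := sz_bool_le (step s b).2
      have h3 := sz_pos s.2
      simp only [sz_pair, Polynomial.eval_ofNat, List.drop_one, step] at h1 h2 ⊢
      omega
  have h2 : PolyTime (fun a => ((f a).foldl step (g a, true)).2 &&
    ((f a).foldl step (g a, true)).1.isEmpty) := by fun_prop
  simpa [key] using h2

@[fun_prop]
theorem PolyTime.decide_mem_name {f : α → Name} {g : α → List Name} (hf : PolyTime f)
    (hg : PolyTime g) :
    PolyTime (fun a => decide (f a ∈ g a)) := by
  have : PolyTime (fun a => (g a).any fun n => decide (f a = n)) := by fun_prop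
  convert this using 2 with a
  rw [Bool.eq_iff_iff]
  simp

end
end WeightedEpistemic

namespace WeightedEpistemic

open Turing Enc

/-! ### Decision procedures as Turing machines -/

namespace Cmd

/-- The loop which reads the input. -/
noncomputable def readLoop : Cmd :=
  .loop Option.isSome (.seq (.case fun v => match v with
    | some (.inr s) => .seq (const (toCode s)) (.push .val fun _ => true)
    | _ => .load id) (.pop none))

/-- Each letter read is put in front of the list built so far, so the input arrives in reverse
order. As in other loops, the current letter is in the buffer. -/
theorem runs_readLoop {B : ℕ} (hB : ∀ s : Sym, sz s ≤ B) (z y : List Sym) :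
    Runs readLoop (z.head?.map .inr, mkStacks (toCode y).write [] [] [] z.tail)
      (valState (toCode (z.reverse ++ y)).write) (z.length * (B + 4) + 1) := by
  induction z generalizing y with
  | nil => exact (Runs.loop_done rfl).mono (by simp)
  | cons s z ih =>
    refine (Runs.loop_step (t := B + 3) rfl ?_ (ih (s :: y))).mono ?_ |>.cast (by simp)
    · refine (Runs.case_seq (t := B + 2) (Runs.seq_assoc ?_)).mono (by omega)
      have h1 := Runs.push_seq .val (fun _ => true) (d := .pop none) (v := some (.inr s))
        (S := mkStacks ((toCode s).write ++ (toCode y).write) [] [] [] z) (t := 1)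
        ((Runs.pop none _ _).cast rfl)
      refine (((runs_const (toCode s) (some (.inr s)) (toCode y).write z).seq h1).mono ?_).cast ?_
      · have := hB s
        simp only [sz] at this
        omega
      · simp [toBuf, toCode_cons, Code.write]
    · simp only [List.length_cons]
      ring_nf
      omega

/-- Replace the tree of a truth value by a single bit. -/
def answer : Cmd :=
  .seq (.pop (some .val)) (.case fun v => if v = bitBuf true then
    .seq (.pop (some .val)) (.seq (.pop (some .val)) (.seq (.push .val fun _ => true)
      (.load fun _ => none))) else
    .seq (.push .val fun _ => false) (.load fun _ => none))

theorem runs_answer (b : Bool) :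
    Runs answer (valState (toCode b).write) (valState [b]) 6 := by
  refine Runs.pop_seq _ (t := 5) ((Runs.case (t := 4) ?_).mono (by omega))
  cases b
  · rw [if_neg (by simp [toCode, Code.write, toBuf])]
    exact ((Runs.push_seq _ _ (t := 1) ((Runs.load _ _ _).cast
        (by simp [valState, toCode, Code.write]))
      ).mono (by omega))
  · rw [if_pos (by simp [toCode, Code.write, toBuf])]
    exact Runs.pop_seq _ (t := 3) (Runs.pop_seq _ (t := 2) (Runs.push_seq _ _ (t := 1)
      ((Runs.load _ _ _).cast (by simp [valState, toCode, Code.write]))))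

/-- The Turing machine of a program. -/
noncomputable def machine (c : Cmd) : FinTM2 where
  K := Stack
  k₀ := none
  k₁ := some .val
  Γ := StackSym
  Λ := Option c.Lab
  main := some c.entry
  σ := Buf
  initialState := none
  Γk₀Fin := inferInstanceAs (Fintype Sym)
  m l := match l with
    | none => .halt
    | some l => c.code some none l

end Cmd

/-- A set of strings is in P if its characteristic function is computable in polynomial time on
trees. -/
theorem inP_of_polyTime {L : Set (List Sym)} {f : List Sym → Bool} (hf : PolyTime f)
    (hL : ∀ z, f z = true ↔ z ∈ L) : InP L := by
  refine ⟨f, hL, ?_⟩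
  -- Reading the input reverses it, and this second reversal compensates.
  have hf' : PolyTime fun z : List Sym => f z.reverse := by fun_prop
  obtain ⟨c, p, hc⟩ := hf'
  obtain ⟨B, hB⟩ : ∃ B, ∀ s : Sym, sz s ≤ B :=
    ⟨Finset.univ.sup sz, fun s => Finset.le_sup (f := sz) (Finset.mem_univ s)⟩
  have hsz : ∀ z : List Sym, sz z ≤ z.length * (B + 1) + 1 := by
    intro z
    induction z with
    | nil => simp
    | cons s z ih =>
      have := hB s
      simp only [sz_cons, List.length_cons]
      ring_nf at ih ⊢
      omega
  let prog : Cmd := .seq (.seq (.push .val fun _ => false) (.seq (.pop none) Cmd.readLoop))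
    (.seq c Cmd.answer)
  have hprog : ∀ z : List Sym, Runs prog (none, mkStacks [] [] [] [] z) (valState [f z])
      (z.length * (B + 4) + 3 + (p.eval (z.length * (B + 1) + 1) + 6)) := by
    intro z
    have h1 := Cmd.runs_readLoop hB z []
    have h2 := (hc z.reverse).2 []
    simp only [List.append_nil, List.reverse_reverse] at h1 h2
    have h3 := eval_le_eval p (hsz z.reverse)
    rw [List.length_reverse] at h3
    refine (Runs.push_seq _ _ (Runs.pop_seq _ (h1.of_eq ?_))).seq
      ((h2.mono h3).seq (Cmd.runs_answer _))
    simp [toBuf, toCode, Code.write]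
  refine ⟨⟨⟨Cmd.machine prog, Equiv.refl _, Equiv.refl _⟩,
    .X * Polynomial.C (B + 4) + 10 + p.comp (.X * Polynomial.C (B + 1) + 1), fun z => ?_⟩⟩
  have h := hprog z
  choose n hn h using h
  have h1 := h.evals (Cmd.machine prog).m Option.some none fun l => rfl
  -- A run of the program ends with the jump to the exit label `none`; one more step executes the
  -- halt instruction there.
  refine ⟨⟨1 + n, ?_⟩, ?_⟩
  · have h0 : initList (Cmd.machine prog) (List.map (Equiv.refl Sym).invFun (id z)) =
        ⟨some (some prog.entry), none, mkStacks [] [] [] [] z⟩ := by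
      simp only [initList]
      congr 1
      funext k
      rcases k with _ | _ | _ | _ | _
      · exact List.map_id z
      all_goals rfl
    have h2 : haltList (Cmd.machine prog) (List.map (Equiv.refl Bool).invFun
        (Computability.encodeBool (f z))) = ⟨none, none, mkStacks [f z] [] [] [] []⟩ := by
      simp only [haltList]
      congr 1
      funext k
      rcases k with _ | _ | _ | _ | _ <;> rfl
    rw [Function.iterate_add_apply]
    refine (congrArg _ ((congrArg (fun x => _^[n] (some x)) h0).trans h1)).trans ?_
    refine (Cmd.iterate_step_one (m := (Cmd.machine prog).m) rfl _ _).trans ?_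
    exact congrArg some h2.symm
  · simp only [Polynomial.eval_add, Polynomial.eval_mul, Polynomial.eval_X, Polynomial.eval_C,
      Polynomial.eval_ofNat, Polynomial.eval_comp, Polynomial.eval_one, id]
    omega

end WeightedEpistemic

namespace WeightedEpistemic

open Enc

/-! ### Parsers -/

section

variable {α β : Type}

/-- The parser `p` splits a value off the beginning of a string. It accepts the values that satisfy
`V`, which are written by `w`. -/
def Parsing.Reads (p : List Sym → Option (α × List Sym)) (V : α → Prop) (w : α → List Sym) : Prop :=
  ∀ z a r, p z = some (a, r) ↔ V a ∧ z = w a ++ r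

namespace Parsing

/-- One parser after another. -/
def pair (p : List Sym → Option (α × List Sym)) (q : List Sym → Option (β × List Sym)) :
    List Sym → Option ((α × β) × List Sym) := fun z =>
  (p z).bind fun x => (q x.2).map fun y => ((x.1, y.1), y.2)

theorem reads_pair {p : List Sym → Option (α × List Sym)} {q : List Sym → Option (β × List Sym)}
    {V : α → Prop} {V' : β → Prop}
    {w : α → List Sym} {w' : β → List Sym} (hp : Reads p V w) (hq : Reads q V' w') :
    Reads (pair p q) (fun x => V x.1 ∧ V' x.2) (fun x => w x.1 ++ w' x.2) := by
  rintro z ⟨a, b⟩ r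
  simp only [pair, Option.bind_eq_some_iff, Option.map_eq_some_iff, Prod.exists, Prod.mk.injEq]
  constructor
  · rintro ⟨a', r', h1, b', r'', h2, ⟨rfl, rfl⟩, rfl⟩
    obtain ⟨h3, rfl⟩ := (hp _ _ _).1 h1
    obtain ⟨h4, rfl⟩ := (hq _ _ _).1 h2
    exact ⟨⟨h3, h4⟩, by simp⟩
  · rintro ⟨⟨h1, h2⟩, rfl⟩
    exact ⟨a, w' b ++ r, (hp _ _ _).2 ⟨h1, by simp⟩, b, r, (hq _ _ _).2 ⟨h2, rfl⟩, ⟨rfl, rfl⟩, rfl⟩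

/-- One step of a repeated application of the parser `p`. The state contains the values that have
been found, the remaining string, and whether the end mark `e` has been reached. -/
def manyStep (p : List Sym → Option (α × List Sym)) (e : Sym)
    (s : Option (List α × List Sym × Bool)) :
    Option (List α × List Sym × Bool) :=
  s.bind fun x => bif x.2.2 then some x else
    x.2.1.head?.bind fun t => bif decide (t = e) then some (x.1, x.2.1.tail, true) else
      (p x.2.1).map fun y => (y.1 :: x.1, y.2, false)

/-- Apply the parser `p` repeatedly, up to the end mark `e`. -/
def many (p : List Sym → Option (α × List Sym)) (e : Sym) :
    List Sym → Option ((List α) × List Sym) := fun z =>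
  ((manyStep p e)^[z.length] (some ([], z, false))).bind fun x =>
    bif x.2.2 then some (x.1.reverse, x.2.1) else none

theorem iterate_manyStep_none (p : List Sym → Option (α × List Sym)) (e : Sym) (n : ℕ) :
    (manyStep p e)^[n] none = none :=
  Function.iterate_fixed rfl n

theorem iterate_manyStep_done (p : List Sym → Option (α × List Sym)) (e : Sym) (n : ℕ) (l : List α)
    (z : List Sym) :
    (manyStep p e)^[n] (some (l, z, true)) = some (l, z, true) :=
  Function.iterate_fixed (by simp [manyStep]) n

/-- No valid value begins with the end mark, so one letter of look-ahead tells whether the list goes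
on. Every step consumes a letter, so the length of the string is enough iterations, and finished
states are fixed. `h1` gives that written lists are read, `h2` that nothing else is accepted. -/
theorem reads_many {p : List Sym → Option (α × List Sym)} {V : α → Prop} {w : α → List Sym}
    {e : Sym} (hp : Reads p V w)
    (hw : ∀ a, V a → ∃ s t, w a = s :: t ∧ s ≠ e) :
    Reads (many p e) (fun l => ∀ a ∈ l, V a) (fun l => l.flatMap w ++ [e]) := by
  have h1 : ∀ (l : List α) (n : ℕ) (m : List α) (r : List Sym), (∀ a ∈ l, V a) →
      (l.flatMap w ++ e :: r).length ≤ n →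
      (manyStep p e)^[n] (some (m, l.flatMap w ++ e :: r, false)) =
        some (l.reverse ++ m, r, true) := by
    intro l
    induction l with
    | nil =>
      rintro (_ | n) m r - hn
      · simp at hn
      · rw [Function.iterate_succ_apply]
        simpa [manyStep] using iterate_manyStep_done p e n m r
    | cons a l ih =>
      intro n m r hV hn
      obtain ⟨s, t, h, hs⟩ := hw a (hV a (by simp))
      rcases n with _ | n
      · simp at hn
      · have h2 := (hp (w a ++ (l.flatMap w ++ e :: r)) a _).2 ⟨hV a (by simp), rfl⟩
        have h3 := ih n (a :: m) r (fun b hb => hV b (by simp [hb])) (by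
          simp [h] at hn ⊢
          omega)
        rw [Function.iterate_succ_apply]
        simp only [h, List.cons_append] at h2
        simpa [manyStep, h, hs, h2] using h3
  have h2 : ∀ (n : ℕ) (m m' : List α) (z r : List Sym),
      (manyStep p e)^[n] (some (m, z, false)) = some (m', r, true) →
      ∃ l : List α, (∀ a ∈ l, V a) ∧ m' = l.reverse ++ m ∧ z = l.flatMap w ++ e :: r := by
    intro n
    induction n with
    | zero => simp
    | succ n ih =>
      intro m m' z r h
      rw [Function.iterate_succ_apply] at h
      rcases z with _ | ⟨t, z⟩
      · simp [manyStep, iterate_manyStep_none] at h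
      · by_cases ht : t = e
        · simp only [manyStep, Option.bind_some, cond_false, List.head?_cons, ht, decide_true,
            cond_true, List.tail_cons] at h
          rw [iterate_manyStep_done] at h
          simp only [Option.some.injEq, Prod.mk.injEq] at h
          exact ⟨[], by simp, by simp [h.1], by simp [ht, h.2.1]⟩
        · simp only [manyStep, Option.bind_some, cond_false, List.head?_cons, ht, decide_false]
            at h
          rcases hpz : p (t :: z) with _ | ⟨a, z'⟩
          · simp [hpz, iterate_manyStep_none] at h
          · rw [hpz] at h
            obtain ⟨l, hl, rfl, rfl⟩ := ih _ _ _ _ h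
            obtain ⟨ha, hz⟩ := (hp _ _ _).1 hpz
            exact ⟨a :: l, by simpa [ha] using hl, by simp, by simp [hz]⟩
  intro z l r
  simp only [many, Option.bind_eq_some_iff, Prod.exists]
  constructor
  · rintro ⟨m, r', b, h, h'⟩
    cases b
    · simp at h'
    · simp only [cond_true, Option.some.injEq, Prod.mk.injEq] at h'
      obtain ⟨l', hl', rfl, rfl⟩ := h2 _ _ _ _ _ h
      obtain ⟨h3, rfl⟩ := h'
      simp only [List.append_nil, List.reverse_reverse] at h3
      subst h3
      exact ⟨hl', by simp⟩
  · rintro ⟨hV, rfl⟩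
    refine ⟨l.reverse, r, true, ?_, by simp⟩
    simpa using h1 l (l.flatMap w ++ e :: r).length [] r hV le_rfl

/-- A list in brackets. -/
def list (p : List Sym → Option (α × List Sym)) : List Sym → Option ((List α) × List Sym) :=
    fun z =>
  z.head?.bind fun s => bif decide (s = Sym.bra) then many p .ket z.tail else none

theorem reads_list {p : List Sym → Option (α × List Sym)} {V : α → Prop} {w : α → List Sym}
    (hp : Reads p V w)
    (hw : ∀ a, V a → ∃ s t, w a = s :: t ∧ s ≠ .ket) :
    Reads (list p) (fun l => ∀ a ∈ l, V a) (fun l => .bra :: (l.flatMap w ++ [.ket])) := by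
  intro z l r
  have h := reads_many hp hw
  rcases z with _ | ⟨s, z⟩
  · simp [list]
  · by_cases hs : s = .bra
    · simpa [list, hs] using h z l r
    · simp [list, hs]

/-- A bit. -/
def bit : List Sym → Option (Bool × List Sym) := fun z => z.head?.bind fun s => match s with
  | .bit b => some (b, z.tail)
  | _ => none

theorem reads_bit : Reads bit (fun _ => True) (fun b => [.bit b]) := by
  intro z b r
  rcases z with _ | ⟨s, z⟩
  · simp [bit]
  · cases s <;> simp [bit, and_comm]

/-- A name. -/
def name : List Sym → Option (Name × List Sym) := many bit .stop_mark

theorem reads_name : Reads name (fun _ => True) writeName := by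
  intro z n r
  have h := reads_many reads_bit (e := .stop_mark) (fun b _ => ⟨_, _, rfl, by simp⟩) z n r
  simp only [implies_true, true_and, ← List.map_eq_flatMap] at h ⊢
  exact h

theorem exists_writeName (n : Name) : ∃ s t, writeName n = s :: t ∧
    ((∃ b, s = .bit b) ∨ s = .stop_mark) := by
  rcases n with _ | ⟨b, n⟩
  · exact ⟨_, _, rfl, .inr rfl⟩
  · exact ⟨_, _, rfl, .inl ⟨b, rfl⟩⟩

theorem writeName_append_ne_ket (n : Name) (x : List Sym) :
    ∃ s t, writeName n ++ x = s :: t ∧ s ≠ .ket := by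
  obtain ⟨s, t, h, hs⟩ := exists_writeName n
  exact ⟨s, t ++ x, by simp [h], by rcases hs with ⟨b, rfl⟩ | rfl <;> simp⟩

/-- A list of names. -/
def names : List Sym → Option ((List Name) × List Sym) := list name

theorem reads_names : Reads names (fun _ => True) writeNames := by
  intro z n r
  have h := reads_list reads_name (fun b _ => by simpa using writeName_append_ne_ket b []) z n r
  simp only [implies_true, true_and] at h ⊢
  exact h

/-- Bounds the size of the unread part, whatever the number of applications of the parser. -/
theorem suffix {p : List Sym → Option (α × List Sym)} {V : α → Prop} {w : α → List Sym}
    (hp : Reads p V w) {z a r}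
    (h : p z = some (a, r)) : r <:+ z :=
  ⟨w a, ((hp _ _ _).1 h).2.symm⟩

/-! ### Running time of the parsers -/

section

variable [Enc α] [Enc β]

theorem _root_.WeightedEpistemic.sz_le_of_suffix {l m : List α} (h : l <:+ m) : sz l ≤ sz m := by
  rw [List.suffix_iff_eq_drop.1 h]
  exact sz_drop_le _ _

theorem polyTime_pair {p : List Sym → Option (α × List Sym)} {q : List Sym → Option (β × List Sym)}
    (hp : PolyTime p) (hq : PolyTime q) : PolyTime (pair p q) := by
  unfold pair
  fun_prop

/-- The unread part is always a suffix of `z`, so every value found has size at most `q.eval (sz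
z)`, and the list of values grows by a bounded amount per step. -/
theorem polyTime_many {p : List Sym → Option (α × List Sym)} (e : Sym) (hp : PolyTime p)
    (hs : ∀ z a r, p z = some (a, r) → r <:+ z) : PolyTime (many p e) := by
  have hstep : PolyTime (manyStep p e) := by
    unfold manyStep
    fun_prop
  obtain ⟨q, hq⟩ := hp.exists_bound
  have hit : PolyTime (fun z : List Sym => (manyStep p e)^[z.length] (some ([], z, false))) := by
    refine PolyTime.iterate (n := fun z => z) (by fun_prop) (by fun_prop) hstep
      (20 + .X + .X * (1 + q)) ?_
    intro z
    have key : ∀ k, (manyStep p e)^[k] (some ([], z, false)) = none ∨ ∃ l r b,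
        (manyStep p e)^[k] (some ([], z, false)) = some (l, r, b) ∧ r <:+ z ∧
          sz l ≤ 1 + k * (1 + q.eval (sz z)) := by
      intro k
      induction k with
      | zero => exact .inr ⟨[], z, false, rfl, List.suffix_rfl, by simp⟩
      | succ k ih =>
        rw [Function.iterate_succ_apply']
        rcases ih with h | ⟨l, r, b, h, hr, hl⟩
        · exact .inl (by rw [h]; rfl)
        · rw [h]
          have hl' : sz l ≤ 1 + (k + 1) * (1 + q.eval (sz z)) := by
            rw [add_mul]
            omega
          cases b
          · rcases r with _ | ⟨t, r⟩
            · exact .inl rfl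
            · by_cases ht : t = e
              · exact .inr ⟨l, r, true, by simp [manyStep, ht],
                  (List.suffix_cons t r).trans hr, hl'⟩
              · rcases hpz : p (t :: r) with _ | ⟨a, r'⟩
                · exact .inl (by simp [manyStep, ht, hpz])
                · refine .inr ⟨a :: l, r', false, by simp [manyStep, ht, hpz],
                    (hs _ _ _ hpz).trans hr, ?_⟩
                  have h1 := (hq (t :: r)).trans (eval_le_eval q (sz_le_of_suffix hr))
                  rw [hpz] at h1
                  simp only [sz_some, sz_pair, sz_cons, add_mul] at h1 ⊢
                  omega
          · exact .inr ⟨l, r, true, rfl, hr, hl'⟩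
    intro k hk
    simp only [Polynomial.eval_add, Polynomial.eval_mul, Polynomial.eval_X, Polynomial.eval_one,
      Polynomial.eval_ofNat]
    rcases key k with h | ⟨l, r, b, h, hr, hl⟩
    · rw [h, sz_none]
      omega
    · rw [h]
      have h1 := sz_le_of_suffix hr
      have h2 := sz_bool_le b
      have h3 := Nat.mul_le_mul_right (1 + q.eval (sz z)) (hk.trans (length_le_sz z))
      simp only [sz_some, sz_pair]
      omega
  unfold many
  fun_prop

theorem polyTime_list {p : List Sym → Option (α × List Sym)} (hp : PolyTime p)
    (hs : ∀ z a r, p z = some (a, r) → r <:+ z) : PolyTime (list p) := by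
  have := polyTime_many .ket hp hs
  unfold list
  fun_prop

@[fun_prop]
theorem polyTime_bit : PolyTime bit := by
  have : PolyTime (fun x : List Sym × Sym => (match x.2 with
      | .bit b => some (b, x.1.tail)
      | _ => none : Option (Bool × List Sym))) :=
    PolyTime.sym_cases (f := fun s (x : List Sym × Sym) => (match s with
      | .bit b => some (b, x.1.tail)
      | _ => none : Option (Bool × List Sym))) PolyTime.snd fun s => by cases s <;> fun_prop
  exact PolyTime.bind (o := fun z : List Sym => z.head?) (by fun_prop) this

@[fun_prop]
theorem polyTime_name : PolyTime name :=
  polyTime_many _ polyTime_bit fun _ _ _ h => suffix reads_bit h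

@[fun_prop]
theorem polyTime_names : PolyTime names :=
  polyTime_list polyTime_name fun _ _ _ h => suffix reads_name h

end

end Parsing
end
end WeightedEpistemic

namespace WeightedEpistemic

open Enc Parsing

/-! ### Tokens of formulas -/

/-- A token of a formula consists of its operator, a list of names and a name. The end of a name
stands for the operator of an atom. In the token of `(≡_b)_a`, the list is `[b]`. -/
abbrev Token := Sym × List Name × Name

/-- The components that a token does not need are empty. -/
def Token.Valid (t : Token) : Prop :=
  match t.1 with
  | .stop_mark | .know => t.2.1 = []
  | .neg | .imp => t.2.1 = [] ∧ t.2.2 = []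
  | .op .upskill | .op .downskill | .op .reskill => True
  | .op .learn => ∃ b, t.2.1 = [b]
  | .op _ => t.2.2 = []
  | _ => False

/-- The string for a token. -/
def Token.write (t : Token) : List Sym :=
  match t.1 with
  | .stop_mark => writeName t.2.2
  | .know => .know :: writeName t.2.2
  | .op .upskill | .op .downskill | .op .reskill => t.1 :: (writeNames t.2.1 ++ writeName t.2.2)
  | .op .learn => t.1 :: (t.2.1.flatMap writeName ++ writeName t.2.2)
  | .op _ => t.1 :: writeNames t.2.1
  | s => [s]

/-- The parser for tokens, given the first symbol. -/
def Parsing.tokenOf (s : Sym) (z : List Sym) : Option (Token × List Sym) :=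
  match s with
  | .bit _ | .stop_mark => (name z).map fun x => ((.stop_mark, [], x.1), x.2)
  | .know => (name z.tail).map fun x => ((s, [], x.1), x.2)
  | .neg | .imp => some ((s, [], []), z.tail)
  | .op .upskill | .op .downskill | .op .reskill =>
    (pair names name z.tail).map fun x => ((s, x.1.1, x.1.2), x.2)
  | .op .learn => (pair name name z.tail).map fun x => ((s, [x.1.1], x.1.2), x.2)
  | .op _ => (names z.tail).map fun x => ((s, x.1, []), x.2)
  | _ => none

/-- The parser for tokens. -/
def Parsing.token (z : List Sym) : Option (Token × List Sym) :=
  z.head?.bind fun s => tokenOf s z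

theorem Parsing.token_write {t : Token} (ht : t.Valid) (r : List Sym) :
    token (t.write ++ r) = some (t, r) := by
  have hn := fun n z => (reads_name (writeName n ++ z) n z).2 ⟨trivial, rfl⟩
  have hl := fun l z => (reads_names (writeNames l ++ z) l z).2 ⟨trivial, rfl⟩
  obtain ⟨s, l, n⟩ := t
  rcases s with b | _ | _ | _ | _ | _ | _ | f
  case stop_mark =>
    obtain rfl : l = [] := ht
    obtain ⟨s, y, h, hs⟩ := exists_writeName n
    have h1 := hn n r
    -- An atom has no operator in front: the first symbol selects the case but still belongs to the
    -- name, so it is not skipped.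
    have h2 : token (writeName n ++ r) =
        (name (writeName n ++ r)).map fun x => ((.stop_mark, [], x.1), x.2) := by
      rw [h]
      rcases hs with ⟨b, rfl⟩ | rfl <;> rfl
    exact h2.trans (by rw [h1]; rfl)
  case op =>
    cases f
    case learn =>
      obtain ⟨b, rfl⟩ := ht
      simp [Token.write, token, tokenOf, pair, hn]
    all_goals simp_all [Token.Valid, Token.write, token, tokenOf, pair]
  all_goals simp_all [Token.Valid, Token.write, token, tokenOf]

theorem Parsing.eq_of_token {t : Token} {z r : List Sym} (h : token z = some (t, r)) :
    t.Valid ∧ z = t.write ++ r := by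
  have hn := fun z n r => (reads_name z n r).1
  have hl := fun z l r => (reads_names z l r).1
  have hnn := fun z l r => (reads_pair reads_name reads_name z l r).1
  have hln := fun z l r => (reads_pair reads_names reads_name z l r).1
  rcases z with _ | ⟨s, z⟩
  · simp [token] at h
  · simp only [token, List.head?_cons, Option.bind_some] at h
    rcases s with b | _ | _ | _ | _ | _ | _ | f
    case op =>
      cases f
      all_goals
        simp only [tokenOf, Option.map_eq_some_iff, Prod.mk.injEq, List.tail_cons] at h
        obtain ⟨x, h, rfl, rfl⟩ := h
      case learn => simp [Token.Valid, Token.write, (hnn _ _ _ h).2]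
      case upskill | downskill | reskill => simp [Token.Valid, Token.write, (hln _ _ _ h).2]
      all_goals simp [Token.Valid, Token.write, (hl _ _ _ h).2]
    case neg | imp =>
      simp only [tokenOf, Option.some.injEq, Prod.mk.injEq] at h
      obtain ⟨rfl, rfl⟩ := h
      simp [Token.Valid, Token.write]
    case bra | ket => simp [tokenOf] at h
    all_goals
      simp only [tokenOf, Option.map_eq_some_iff, Prod.mk.injEq] at h
      obtain ⟨x, h, rfl, rfl⟩ := h
      simp [Token.Valid, Token.write, ← (hn _ _ _ h).2]

theorem Parsing.reads_token : Reads token Token.Valid Token.write := fun _ _ _ =>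
  ⟨eq_of_token, fun ⟨h, h'⟩ => h' ▸ token_write h _⟩

theorem Token.write_ne_ket {t : Token} (ht : t.Valid) : ∃ s z, t.write = s :: z ∧ s ≠ .ket := by
  obtain ⟨s, l, n⟩ := t
  rcases s with b | _ | _ | _ | _ | _ | _ | f
  case stop_mark => simpa [Token.write] using writeName_append_ne_ket n []
  case op => cases f <;> simp [Token.write]
  all_goals simp_all [Token.Valid, Token.write]

@[fun_prop]
theorem Parsing.polyTime_token : PolyTime token := by
  have : PolyTime (fun x : List Sym × Sym => tokenOf x.2 x.1) :=
    PolyTime.sym_cases (f := fun s (x : List Sym × Sym) => tokenOf s x.1) PolyTime.snd fun s => by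
      have h1 : PolyTime (pair names name) := polyTime_pair polyTime_names polyTime_name
      have h2 : PolyTime (pair name name) := polyTime_pair polyTime_name polyTime_name
      rcases s with b | _ | _ | _ | _ | _ | _ | f
      case op => cases f <;> unfold tokenOf <;> fun_prop
      all_goals unfold tokenOf; fun_prop
  exact PolyTime.bind (o := fun z : List Sym => z.head?) (by fun_prop) this

/-- The lists of worlds, edges, capabilities and values that present a model. -/
abbrev Lists := List Name × List (Name × Name × List Name) × List (Name × List Name) ×
  List (Name × List Name)

/-- The lists of a model. -/
def ModelData.lists (D : ModelData) : Lists := (D.worlds, D.edges, D.capabilities, D.valuation)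

/-- The string for a pair of a name and a list of names. -/
def writeEntry (t : Name × List Name) : List Sym := writeName t.1 ++ writeNames t.2

/-- The string for the lists that present a model. -/
def Lists.write (D : Lists) : List Sym :=
  writeNames D.1 ++ (.bra :: (D.2.1.flatMap (fun t => writeName t.1 ++ writeEntry t.2) ++ [.ket]) ++
    (.bra :: (D.2.2.1.flatMap writeEntry ++ [.ket]) ++
      .bra :: (D.2.2.2.flatMap writeEntry ++ [.ket])))

theorem ModelData.write_lists (D : ModelData) : D.lists.write = D.write := by
  simp [lists, write, Lists.write, show writeEntry = fun t => writeName t.1 ++ writeNames t.2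
      from rfl]

/-- The parser for a name and a list of names. -/
def Parsing.entry : List Sym → Option ((Name × List Name) × List Sym) := pair name names

/-- The parser for a model. -/
def Parsing.lists : List Sym → Option (Lists × List Sym) :=
  pair names (pair (list (pair name entry)) (pair (list entry) (list entry)))

theorem Parsing.reads_entry : Reads entry (fun _ => True) writeEntry := by
  intro z a r
  simpa [entry, writeEntry] using reads_pair reads_name reads_names z a r

theorem Parsing.reads_lists : Reads lists (fun _ => True) Lists.write := by
  have h1 := reads_list (reads_pair reads_name reads_entry) fun a _ =>
    writeName_append_ne_ket a.1 _
  have h2 := reads_list reads_entry fun a _ => writeName_append_ne_ket a.1 _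
  intro z a r
  simpa [lists, Lists.write] using reads_pair reads_names (reads_pair h1 (reads_pair h2 h2)) z a r

theorem Parsing.polyTime_entry : PolyTime entry :=
  polyTime_pair polyTime_name polyTime_names

@[fun_prop]
theorem Parsing.polyTime_lists : PolyTime lists := by
  have h1 := polyTime_list (polyTime_pair polyTime_name polyTime_entry) fun _ _ _ =>
    suffix (reads_pair reads_name reads_entry)
  have h2 := polyTime_list polyTime_entry fun _ _ _ => suffix reads_entry
  exact polyTime_pair polyTime_names (polyTime_pair h1 (polyTime_pair h2 h2))

/-- The parser for a model, a world and the tokens of a formula. -/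
def Parsing.input (z : List Sym) : Option ((Lists × Name) × List Token) :=
  (pair lists name z).bind fun x => (many token .ket (x.2 ++ [Sym.ket])).bind fun y =>
    bif y.2.isEmpty then some (x.1, y.1) else none

/-- A formula has no end mark, so `input` appends one. A `ket` met earlier at the end of a token
leaves symbols unread, and the input is rejected. -/
theorem Parsing.input_eq_some_iff {z : List Sym} {D : Lists} {w : Name} {ts : List Token} :
    input z = some ((D, w), ts) ↔
      (∀ t ∈ ts, t.Valid) ∧ z = D.write ++ writeName w ++ ts.flatMap Token.write := by
  have h1 := reads_pair reads_lists reads_name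
  have h2 := reads_many (e := .ket) reads_token fun t ht => Token.write_ne_ket ht
  simp only [input, Option.bind_eq_some_iff]
  constructor
  · rintro ⟨⟨⟨D', w'⟩, r⟩, h3, ⟨ts', r'⟩, h4, h5⟩
    obtain ⟨-, rfl⟩ := (h1 _ _ _).1 h3
    obtain ⟨hV, h4⟩ := (h2 _ _ _).1 h4
    rcases r' with _ | ⟨s, r'⟩
    · simp only [List.isEmpty_nil, cond_true, Option.some.injEq, Prod.mk.injEq] at h5
      obtain ⟨⟨rfl, rfl⟩, rfl⟩ := h5
      simp only [List.append_nil] at h4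
      rw [List.append_cancel_right h4]
      exact ⟨hV, rfl⟩
    · simp at h5
  · rintro ⟨hV, rfl⟩
    exact ⟨((D, w), _), (h1 _ _ _).2 ⟨⟨trivial, trivial⟩, rfl⟩, (ts, []),
      (h2 _ _ _).2 ⟨hV, by simp⟩, rfl⟩

@[fun_prop]
theorem Parsing.polyTime_input : PolyTime input := by
  have h1 : PolyTime (pair lists name) := polyTime_pair polyTime_lists polyTime_name
  have h2 : PolyTime (many token .ket) :=
    polyTime_many _ polyTime_token fun _ _ _ => suffix reads_token
  unfold input
  fun_prop

end WeightedEpistemic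

namespace WeightedEpistemic

open Enc

/-! ### The model checking algorithm -/

namespace Lists

/-- Whether `s` is a skill of the edge between `u` and `v`. -/
def edgeMem (D : Lists) (u v : Name) (s : Skill) : Bool :=
  D.2.1.any fun t => ((decide (t.1 = u) && decide (t.2.1 = v)) ||
    (decide (t.1 = v) && decide (t.2.1 = u))) && decide (s ∈ t.2.2)

/-- Whether `s` is a skill of `a` in the presented model. -/
def capMem (D : Lists) (a : Agent) (s : Skill) : Bool :=
  D.2.2.1.any fun t => decide (t.1 = a) && decide (s ∈ t.2)

/-- Whether `p` is true at `u`. -/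
def valMem (D : Lists) (u : Name) (p : Atom) : Bool :=
  D.2.2.2.any fun t => decide (t.1 = u) && decide (p ∈ t.2)

/-- One step of tracing the skill `s` of an agent back through the updates of a model. The state is
the agent in question, and the answer if it has been found. -/
def traceStep (s : Skill) (x : Agent × Option Bool) (t : Token) : Agent × Option Bool :=
  bif x.2.isNone && decide (t.2.2 = x.1) then
    match t.1 with
    | .op .upskill => (x.1, bif decide (s ∈ t.2.1) then some true else none)
    | .op .downskill => (x.1, bif decide (s ∈ t.2.1) then some false else none)
    | .op .reskill => (x.1, some (decide (s ∈ t.2.1)))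
    | .op .learn => (t.2.1.headD [], none)
    | _ => x
  else x

/-- Whether `s` is a skill of `a` after the updates `c`, of which the latest comes first. -/
def skillMem (D : Lists) (c : List Token) (a : Agent) (s : Skill) : Bool :=
  (c.foldl (traceStep s) (a, none)).2.elim (D.capMem (c.foldl (traceStep s) (a, none)).1 s)
      fun b => b

/-- All skills that an agent may have after the updates `c`. -/
def skills (D : Lists) (c : List Token) : List Skill :=
  D.2.2.1.flatMap (fun t => t.2) ++ c.flatMap fun t => t.2.1

/-- Whether all worlds whose edge from `u` contains the skills in `need` belong to `P`. -/
def box (D : Lists) (c : List Token) (need : Skill → Bool) (P : List Name) (u : Name) : Bool :=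
  D.1.all fun v => !((D.skills c).all fun s => !need s || D.edgeMem u v s) || decide (v ∈ P)

/-- The worlds at which all agents in `G` know `P`. -/
def everyone (D : Lists) (c : List Token) (G : List Agent) (P : List Name) : List Name :=
  D.1.filter fun u => G.all fun a => D.box c (fun s => D.skillMem c a s) P u

/-- The worlds at which `P` is common knowledge in `G`. -/
def common (D : Lists) (c : List Token) (G : List Agent) (P : List Name) : List Name :=
  D.1.foldl (fun Q _ => D.everyone c G (P.filter fun u => decide (u ∈ Q))) D.1

/-- One step of the evaluation of a formula from right to left. The stack contains the sets of
worlds at which the subformulas on the right are true. -/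
def evalStep (D : Lists) (vs : List (List Name)) (x : Token × List Token) : List (List Name) :=
  match x.1.1 with
  | .stop_mark => D.1.filter (fun u => D.valMem u x.1.2.2) :: vs
  | .neg => D.1.filter (fun u => !decide (u ∈ vs.headD [])) :: vs.tail
  | .imp => D.1.filter (fun u => !decide (u ∈ vs.headD []) || decide (u ∈ vs.tail.headD [])) ::
      vs.tail.tail
  | .know => D.everyone x.2 [x.1.2.2] (vs.headD []) :: vs.tail
  | .op .common => D.common x.2 x.1.2.1 (vs.headD []) :: vs.tail
  | .op .mutual => D.everyone x.2 x.1.2.1 (vs.headD []) :: vs.tail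
  | .op .distributed => D.1.filter (fun u =>
      D.box x.2 (fun s => x.1.2.1.any fun a => D.skillMem x.2 a s) (vs.headD []) u) :: vs.tail
  | .op .field => D.1.filter (fun u =>
      D.box x.2 (fun s => x.1.2.1.all fun a => D.skillMem x.2 a s) (vs.headD []) u) :: vs.tail
  | _ => vs

end Lists

/-- One step of the annotation of the tokens of a formula, from left to right, with the updates in
whose scope they are. The state contains a stack of the updates for the subformulas which are still
to be read, and the annotated tokens, of which the latest comes first. -/
def annotateStep (x : List (List Token) × List (Token × List Token)) (t : Token) :
    List (List Token) × List (Token × List Token) :=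
  ((match t.1 with
    | .stop_mark => x.1.tail
    | .imp => x.1.headD [] :: x.1
    | .op .upskill | .op .downskill | .op .reskill | .op .learn => (t :: x.1.headD []) :: x.1.tail
    | _ => x.1), (t, x.1.headD []) :: x.2)

/-- Count the subformulas of a sequence of tokens, from right to left. -/
def countStep (t : Token) (n : Option (List Unit)) : Option (List Unit) :=
  n.bind fun n => match t.1 with
    | .stop_mark => some (() :: n)
    | .imp => bif n.tail.isEmpty then none else some n.tail
    | _ => bif n.isEmpty then none else some n

/-- Whether a token belongs to the language with the modalities in `X`. -/
noncomputable def Token.allowed (X : Set Feature) (t : Token) : Bool :=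
  open Classical in
  match t.1 with
  | .op .common => decide (Feature.common ∈ X) && !t.2.1.isEmpty
  | .op .distributed => decide (Feature.distributed ∈ X) && !t.2.1.isEmpty
  | .op .mutual => decide (Feature.mutual ∈ X) && !t.2.1.isEmpty
  | .op .field => decide (Feature.field ∈ X) && !t.2.1.isEmpty
  | .op f => decide (f ∈ X)
  | _ => true

/-- Whether a sequence of tokens is a formula of the language with the modalities in `X`. -/
noncomputable def isFormula (X : Set Feature) (ts : List Token) : Bool :=
  ts.all (Token.allowed X) && (ts.foldr countStep (some [])).elim false fun n =>
    !n.isEmpty && n.tail.isEmpty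

/-- The set of worlds at which a formula is true. -/
def Lists.eval (D : Lists) (ts : List Token) : List Name :=
  ((ts.foldl annotateStep ([[]], [])).2.foldl D.evalStep []).headD []

/-- The model checking algorithm. -/
noncomputable def check (X : Set Feature) (z : List Sym) : Bool :=
  (Parsing.input z).elim false fun x =>
    decide (x.1.2 ∈ x.1.1.1) && isFormula X x.2 && decide (x.1.2 ∈ x.1.1.eval x.2)

/-! ### Running time of the model checking algorithm -/

section

variable {α β : Type} [Enc α] [Enc β]

theorem sz_le_of_sublist {l m : List α} (h : l.Sublist m) : sz l ≤ sz m := by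
  induction h with
  | slnil => simp
  | cons a _ ih => simp; omega
  | cons_cons a _ ih => simpa using ih

theorem sz_headD_le (l : List (List α)) : sz (l.headD []) ≤ sz l := by
  cases l <;> simp; omega

@[fun_prop]
theorem PolyTime.isNone {f : α → Option β} (hf : PolyTime f) : PolyTime (fun a => (f a).isNone) :=
  PolyTime.option_cases hf (.const true) (g := fun _ => false) (by fun_prop)
    (fun a h => by simp [h]) (fun a b h => by simp [h])

namespace Lists

@[fun_prop]
theorem polyTime_edgeMem {D : α → Lists} {u v s : α → Name} (hD : PolyTime D) (hu : PolyTime u)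
    (hv : PolyTime v)
    (hs : PolyTime s) : PolyTime (fun a => (D a).edgeMem (u a) (v a) (s a)) := by
  unfold edgeMem
  fun_prop

@[fun_prop]
theorem polyTime_capMem {D : α → Lists} {u s : α → Name} (hD : PolyTime D) (hu : PolyTime u)
    (hs : PolyTime s) : PolyTime (fun a => (D a).capMem (u a) (s a)) := by
  unfold capMem
  fun_prop

@[fun_prop]
theorem polyTime_valMem {D : α → Lists} {u s : α → Name} (hD : PolyTime D) (hu : PolyTime u)
    (hs : PolyTime s) : PolyTime (fun a => (D a).valMem (u a) (s a)) := by
  unfold valMem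
  fun_prop

theorem polyTime_traceStep : PolyTime (fun x : Skill × (Agent × Option Bool) × Token =>
    traceStep x.1 x.2.1 x.2.2) := by
  unfold traceStep
  refine PolyTime.cond (by fun_prop) ?_ (by fun_prop)
  refine PolyTime.sym_cases (s := fun x : Skill × (Agent × Option Bool) × Token => x.2.2.1)
    (f := fun t x => match t with
    | .op .upskill => (x.2.1.1, bif decide (x.1 ∈ x.2.2.2.1) then some true else none)
    | .op .downskill => (x.2.1.1, bif decide (x.1 ∈ x.2.2.2.1) then some false else none)
    | .op .reskill => (x.2.1.1, some (decide (x.1 ∈ x.2.2.2.1)))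
    | .op .learn => (x.2.2.2.1.headD [], none)
    | _ => x.2.1) (by fun_prop) fun t => ?_
  rcases t with _ | _ | _ | _ | _ | _ | _ | f
  case op => cases f <;> dsimp only <;> fun_prop
  all_goals dsimp only; fun_prop

/-- The agent changes only through learning, and then to a name in the token; the answer has bounded
size. -/
theorem sz_traceStep_le (s : Skill) (x : Agent × Option Bool) (t : Token) :
    sz (traceStep s x t) ≤ sz x + (5 + sz t) := by
  have h1 := sz_headD_le t.2.1
  have h2 : ∀ b : Option Bool, sz b ≤ 5 := by
    rintro (_ | b)
    · simp
    · have := sz_bool_le b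
      simp
      omega
  have h3 : ∀ y, traceStep s x t = y → sz y.1 ≤ sz x.1 + sz t.2.1 → sz (traceStep s x t) ≤
      sz x + (5 + sz t) := by
    rintro y rfl h
    have := h2 (traceStep s x t).2
    simp only [sz_pair]
    omega
  refine h3 _ rfl ?_
  unfold traceStep
  cases x.2.isNone && decide (t.2.2 = x.1)
  · simp
  · rcases t.1 with _ | _ | _ | _ | _ | _ | _ | f
    case op =>
      cases f
      case learn => exact h1.trans (Nat.le_add_left _ _)
      all_goals simp
    all_goals simp

@[fun_prop]
theorem polyTime_skillMem {D : α → Lists} {c : α → List Token} {u s : α → Name} (hD : PolyTime D)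
    (hc : PolyTime c) (hu : PolyTime u) (hs : PolyTime s) :
    PolyTime (fun a => (D a).skillMem (c a) (u a) (s a)) := by
  obtain ⟨q, hq⟩ := hc.exists_bound
  have h : PolyTime (fun a => (c a).foldl (traceStep (s a)) (u a, none)) :=
    PolyTime.foldl_of_le (f := fun a => traceStep (s a)) hc (by fun_prop)
      (polyTime_traceStep.comp (f := fun x : α × (Agent × Option Bool) × Token => (s x.1, x.2))
        (by fun_prop)) (5 + q) fun a x t ht => by
      have h1 := sz_traceStep_le (s a) x t
      have h2 := (sz_le_of_mem ht).trans (hq a)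
      simp only [Polynomial.eval_add, Polynomial.eval_ofNat]
      omega
  unfold skillMem
  fun_prop

@[fun_prop]
theorem polyTime_skills {D : α → Lists} {c : α → List Token} (hD : PolyTime D) (hc : PolyTime c) :
    PolyTime (fun a => (D a).skills (c a)) := by
  unfold skills
  fun_prop

@[fun_prop]
theorem polyTime_box {D : α → Lists} {c : α → List Token} {need : α → Skill → Bool}
    {P : α → List Name} {u : α → Name} (hD : PolyTime D) (hc : PolyTime c)
    (hneed : PolyTime (fun x : α × Skill => need x.1 x.2)) (hP : PolyTime P) (hu : PolyTime u) :
    PolyTime (fun a => (D a).box (c a) (need a) (P a) (u a)) := by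
  unfold box
  have h : PolyTime (fun x : (α × Name) × Skill => need x.1.1 x.2) :=
    hneed.comp (f := fun x : (α × Name) × Skill => (x.1.1, x.2)) (by fun_prop)
  fun_prop

@[fun_prop]
theorem polyTime_everyone {D : α → Lists} {c : α → List Token} {G : α → List Agent}
    {P : α → List Name} (hD : PolyTime D) (hc : PolyTime c) (hG : PolyTime G) (hP : PolyTime P) :
    PolyTime (fun a => (D a).everyone (c a) (G a) (P a)) := by
  unfold everyone
  fun_prop

theorem everyone_sublist (D : Lists) (c : List Token) (G : List Agent) (P : List Name) :
    (D.everyone c G P).Sublist D.1 :=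
  List.filter_sublist

/-- Keeps the intermediate sets in the iteration for common knowledge below the size of the list of
worlds. -/
theorem common_sublist (D : Lists) (c : List Token) (G : List Agent) (P l : List Name) :
    (l.foldl (fun Q _ => D.everyone c G (P.filter fun u => decide (u ∈ Q))) D.1).Sublist D.1 := by
  induction l using List.reverseRecOn with
  | nil => simp
  | append_singleton l a _ => simpa using everyone_sublist D c G _

@[fun_prop]
theorem polyTime_common {D : α → Lists} {c : α → List Token} {G : α → List Agent}
    {P : α → List Name} (hD : PolyTime D) (hc : PolyTime c) (hG : PolyTime G) (hP : PolyTime P) :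
    PolyTime (fun a => (D a).common (c a) (G a) (P a)) := by
  obtain ⟨q, hq⟩ := (PolyTime.fst.comp hD).exists_bound
  exact PolyTime.foldl (l := fun a => (D a).1) (f := fun a Q _ => (D a).everyone (c a) (G a)
    ((P a).filter fun u => decide (u ∈ Q))) (by fun_prop) (by fun_prop) (by fun_prop) q
    fun a k => (sz_le_of_sublist (common_sublist _ _ _ _ _)).trans (hq a)

theorem polyTime_evalStep : PolyTime (fun x : Lists × List (List Name) × Token × List Token =>
    x.1.evalStep x.2.1 x.2.2) := by
  refine PolyTime.sym_cases (s := fun x : Lists × List (List Name) × Token × List Token =>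
      x.2.2.1.1)
    (f := fun t x => x.1.evalStep x.2.1 ((t, x.2.2.1.2), x.2.2.2)) (by fun_prop) fun t => ?_
  rcases t with _ | _ | _ | _ | _ | _ | _ | f
  case op => cases f <;> dsimp only [evalStep] <;> fun_prop
  all_goals dsimp only [evalStep]; fun_prop

/-- A step pushes at most one set, a sublist of the worlds, so growth is additive. -/
theorem sz_evalStep_le (D : Lists) (vs : List (List Name)) (x : Token × List Token) :
    sz (D.evalStep vs x) ≤ sz vs + (1 + sz D) := by
  have h1 : ∀ P : List Name, P.Sublist D.1 → ∀ vs' : List (List Name), vs'.Sublist vs →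
      sz (P :: vs') ≤ sz vs + (1 + sz D) := by
    intro P hP vs' hvs
    have h2 := sz_le_of_sublist hP
    have h3 := sz_le_of_sublist hvs
    rw [sz_cons, sz_pair D]
    omega
  have h2 := List.tail_sublist vs
  have h3 := (List.tail_sublist vs.tail).trans h2
  have h4 : sz vs ≤ sz vs + (1 + sz D) := by omega
  unfold evalStep
  rcases x.1.1 with _ | _ | _ | _ | _ | _ | _ | f
  case op =>
    cases f
    case common => exact h1 _ (common_sublist _ _ _ _ _) _ h2
    case upskill | downskill | reskill | learn => exact h4
    all_goals exact h1 _ List.filter_sublist _ h2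
  case stop_mark => exact h1 _ List.filter_sublist _ (List.Sublist.refl _)
  case imp => exact h1 _ List.filter_sublist _ h3
  case neg | know => exact h1 _ List.filter_sublist _ h2
  all_goals exact h4

end Lists

theorem polyTime_annotateStep :
    PolyTime (fun x : (List (List Token) × List (Token × List Token)) × Token =>
    annotateStep x.1 x.2) := by
  refine PolyTime.sym_cases (s := fun x : (List (List Token) × List (Token × List Token)) × Token =>
      x.2.1)
    (f := fun t x => annotateStep x.1 (t, x.2.2)) (by fun_prop) fun t => ?_
  rcases t with _ | _ | _ | _ | _ | _ | _ | f
  case op => cases f <;> dsimp only [annotateStep] <;> fun_prop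
  all_goals dsimp only [annotateStep]; fun_prop

/-- An implication copies the list of updates on top, so the growth of a step depends on the state.
The bound on each single list of updates, which gains at most one token per step, is therefore
carried along. With `C` bounding these lists, a step adds at most two of them, the token and a
constant. -/
theorem sz_annotate_le {B C : ℕ} (l : List Token) (hB : ∀ t ∈ l, sz t ≤ B)
    (hC : 1 + l.length * (1 + B) ≤ C) :
    (∀ c ∈ (l.foldl annotateStep ([[]], [])).1, sz c ≤ 1 + l.length * (1 + B)) ∧
      sz (l.foldl annotateStep ([[]], [])) ≤ 5 + l.length * (5 + B + 2 * C) := by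
  induction l using List.reverseRecOn with
  | nil => simp
  | append_singleton l t ih =>
    simp only [List.length_append, List.length_singleton, add_mul, one_mul] at hC ⊢
    obtain ⟨h1, h2⟩ := ih (fun t ht => hB t (by simp [ht])) (by omega)
    have ht := hB t (by simp)
    rw [List.foldl_append]
    simp only [List.foldl_cons, List.foldl_nil]
    generalize l.foldl annotateStep ([[]], []) = x at h1 h2 ⊢
    obtain ⟨cs, out⟩ := x
    dsimp only at h1
    have h3 : sz (cs.headD []) ≤ 1 + l.length * (1 + B) := by
      rcases cs with _ | ⟨c, cs⟩
      · simp
      · exact h1 c (by simp)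
    have h4 : ∀ c ∈ cs.tail, sz c ≤ 1 + l.length * (1 + B) :=
      fun c hc => h1 c (List.mem_of_mem_tail hc)
    have h5 := sz_le_of_sublist (List.tail_sublist cs)
    have key : ∀ cs', annotateStep (cs, out) t = (cs', (t, cs.headD []) :: out) →
        (∀ c ∈ cs', sz c ≤ 1 + (l.length * (1 + B) + (1 + B))) → sz cs' ≤ sz cs + 2 + C →
        (∀ c ∈ (annotateStep (cs, out) t).1, sz c ≤ 1 + (l.length * (1 + B) + (1 + B))) ∧
        sz (annotateStep (cs, out) t) ≤ 5 + (l.length * (5 + B + 2 * C) + (5 + B + 2 * C)) := by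
      intro cs' h h6 h7
      rw [h]
      refine ⟨h6, ?_⟩
      rw [sz_pair, sz_cons, sz_pair (t, _)]
      rw [sz_pair] at h2
      dsimp only at h2 ⊢
      omega
    obtain ⟨s, t'⟩ := t
    have h6 : ∀ c ∈ cs, sz c ≤ 1 + (l.length * (1 + B) + (1 + B)) := fun c hc => by
      have := h1 c hc
      omega
    have h7 : ∀ c ∈ cs.tail, sz c ≤ 1 + (l.length * (1 + B) + (1 + B)) := fun c hc => by
      have := h4 c hc
      omega
    refine key _ rfl ?_ ?_
    · rcases s with _ | _ | _ | _ | _ | _ | _ | f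
      case op =>
        cases f
        case upskill | downskill | reskill | learn =>
          refine List.forall_mem_cons.2 ⟨?_, h7⟩
          rw [sz_cons]
          dsimp only
          omega
        all_goals exact h6
      case imp =>
        refine List.forall_mem_cons.2 ⟨?_, h6⟩
        dsimp only
        omega
      case stop_mark => exact h7
      all_goals exact h6
    · rcases s with _ | _ | _ | _ | _ | _ | _ | f
      case op =>
        cases f
        case upskill | downskill | reskill | learn =>
          simp only [sz_cons]
          omega
        all_goals dsimp only; omega
      case imp =>
        simp only [sz_cons]
        omega
      all_goals dsimp only; omega

@[fun_prop]
theorem polyTime_annotate {ts : α → List Token} (hts : PolyTime ts) :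
    PolyTime (fun a => (ts a).foldl annotateStep ([[]], [])) := by
  have : PolyTime (fun ts : List Token => ts.foldl annotateStep ([[]], [])) := by
    -- Both the length of a prefix and the size `B` of its tokens are at most `.X`, so `C` can be `1
    -- + .X * (1 + .X)`.
    refine PolyTime.foldl (f := fun _ => annotateStep) (by fun_prop) (by fun_prop)
      (polyTime_annotateStep.comp PolyTime.snd)
      (5 + .X * (5 + .X + 2 * (1 + .X * (1 + .X)))) fun ts k => ?_
    have h1 : (ts.take k).length ≤ sz ts := (List.length_take_le' _ _).trans (length_le_sz _)
    have h2 := (sz_annotate_le (ts.take k) (fun t ht => sz_le_of_mem (List.mem_of_mem_take ht))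
      (Nat.add_le_add_left (Nat.mul_le_mul_right _ h1) 1)).2
    simp only [Polynomial.eval_add, Polynomial.eval_mul, Polynomial.eval_X, Polynomial.eval_one,
      Polynomial.eval_ofNat]
    exact h2.trans (Nat.add_le_add_left (Nat.mul_le_mul_right _ h1) _)
  fun_prop

@[fun_prop]
theorem Lists.polyTime_eval {D : α → Lists} {ts : α → List Token} (hD : PolyTime D)
    (hts : PolyTime ts) :
    PolyTime (fun a => (D a).eval (ts a)) := by
  obtain ⟨q, hq⟩ := hD.exists_bound
  have : PolyTime (fun a => ((ts a).foldl annotateStep ([[]], [])).2.foldl (D a).evalStep []) :=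
    PolyTime.foldl_of_le (f := fun a => (D a).evalStep) (by fun_prop) (by fun_prop)
      (polyTime_evalStep.comp (f := fun x : α × List (List Name) × Token × List Token =>
        (D x.1, x.2)) (by fun_prop)) (1 + q) fun a s b _ => by
      have h1 := (D a).sz_evalStep_le s b
      have h2 := hq a
      simp only [Polynomial.eval_add, Polynomial.eval_one]
      omega
  unfold eval
  fun_prop

@[fun_prop]
theorem Token.polyTime_allowed (X : Set Feature) : PolyTime (Token.allowed X) := by
  refine PolyTime.sym_cases (s := fun t : Token => t.1)
    (f := fun s t => Token.allowed X (s, t.2)) (by fun_prop) fun t => ?_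
  rcases t with _ | _ | _ | _ | _ | _ | _ | f
  case op => cases f <;> dsimp only [Token.allowed] <;> fun_prop
  all_goals dsimp only [Token.allowed]; fun_prop

theorem polyTime_countStep :
    PolyTime (fun x : Token × Option (List Unit) => countStep x.1 x.2) := by
  refine PolyTime.sym_cases (s := fun x : Token × Option (List Unit) => x.1.1)
    (f := fun t x => countStep (t, x.1.2) x.2) (by fun_prop) fun t => ?_
  rcases t with _ | _ | _ | _ | _ | _ | _ | f
  all_goals dsimp only [countStep]; fun_prop

theorem sz_countStep_le (t : Token) (n : Option (List Unit)) :
    sz (countStep t n) ≤ sz n + 2 := by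
  have h0 : sz () = 1 := rfl
  rcases n with _ | n
  · simp [countStep]
  · have h := sz_le_of_sublist (List.tail_sublist n)
    have h' : ∀ m : List Unit, m.Sublist n → sz (some m) ≤ sz (some n) + 2 := fun m hm => by
      have := sz_le_of_sublist hm
      simp only [sz_some]
      omega
    simp only [countStep, Option.bind_some]
    split
    · simp only [sz_some, sz_cons]
      omega
    · cases n.tail.isEmpty
      · exact h' _ (List.tail_sublist n)
      · simp
    · cases n.isEmpty
      · exact h' _ (List.Sublist.refl n)
      · simp

@[fun_prop]
theorem polyTime_isFormula (X : Set Feature) {ts : α → List Token} (hts : PolyTime ts) :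
    PolyTime (fun a => isFormula X (ts a)) := by
  have : PolyTime (fun ts : List Token => ts.foldr countStep (some [])) :=
    PolyTime.foldr_of_le (f := fun _ => countStep) (by fun_prop) (by fun_prop)
      (polyTime_countStep.comp PolyTime.snd) 2 fun a s b _ => by
      simpa using sz_countStep_le b s
  unfold isFormula
  fun_prop

theorem polyTime_check (X : Set Feature) : PolyTime (check X) := by
  unfold check
  fun_prop

end
end WeightedEpistemic

namespace WeightedEpistemic

/-! ### Correctness of the algorithm -/

namespace ModelData

variable (D : ModelData)

/-- The skills of all agents after the updates `c`, of which the latest comes first. -/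
def capsAfter : List Token → Agent → Set Skill
  | [] => D.toModel.C
  | t :: c => match t.1 with
    | .op .upskill => Function.update (capsAfter c) t.2.2 (capsAfter c t.2.2 ∪ {s | s ∈ t.2.1})
    | .op .downskill => Function.update (capsAfter c) t.2.2 (capsAfter c t.2.2 \ {s | s ∈ t.2.1})
    | .op .reskill => Function.update (capsAfter c) t.2.2 {s | s ∈ t.2.1}
    | .op .learn => Function.update (capsAfter c) t.2.2 (capsAfter c (t.2.1.headD []))
    | _ => capsAfter c

/-- The model after the updates `c`. -/
def after (c : List Token) : WeightedModel D.World := { D.toModel with C := D.capsAfter c }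

theorem capMem_iff {a : Agent} {s : Skill} : D.lists.capMem a s = true ↔ s ∈ D.toModel.C a := by
  simp only [Lists.capMem, lists, List.any_eq_true, Bool.and_eq_true, decide_eq_true_eq, toModel,
    Set.mem_ofPred_eq, Prod.exists]
  constructor
  · rintro ⟨_, S, h, rfl, hs⟩
    exact ⟨S, h, hs⟩
  · rintro ⟨S, h, hs⟩
    exact ⟨a, S, h, rfl, hs⟩

theorem valMem_iff {u : D.World} {p : Atom} :
    D.lists.valMem u.1 p = true ↔ p ∈ D.toModel.β u := by
  simp only [Lists.valMem, lists, List.any_eq_true, Bool.and_eq_true, decide_eq_true_eq, toModel,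
    Set.mem_ofPred_eq, Prod.exists]
  constructor
  · rintro ⟨_, S, h, rfl, hs⟩
    exact ⟨S, h, hs⟩
  · rintro ⟨S, h, hs⟩
    exact ⟨u.1, S, h, rfl, hs⟩

theorem edgeMem_iff {u v : D.World} {s : Skill} :
    D.lists.edgeMem u.1 v.1 s = true ↔ s ∈ D.toModel.E u v := by
  simp only [Lists.edgeMem, lists, List.any_eq_true, Bool.and_eq_true, Bool.or_eq_true,
    decide_eq_true_eq, toModel, edgeSet, Set.mem_ofPred_eq, Prod.exists]
  constructor
  · rintro ⟨_, _, S, h, ⟨rfl, rfl⟩ | ⟨rfl, rfl⟩, hs⟩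
    · exact ⟨S, .inl h, hs⟩
    · exact ⟨S, .inr h, hs⟩
  · rintro ⟨S, h | h, hs⟩
    · exact ⟨_, _, S, h, .inl ⟨rfl, rfl⟩, hs⟩
    · exact ⟨_, _, S, h, .inr ⟨rfl, rfl⟩, hs⟩

theorem foldl_traceStep_some (s : Skill) (c : List Token) (a : Agent) (b : Bool) :
    c.foldl (Lists.traceStep s) (a, some b) = (a, some b) := by
  induction c with
  | nil => rfl
  | cons t c ih => simpa [Lists.traceStep] using ih

/-- Only updates of the agent in question matter. The latest of them settles whether `s` is a skill,
or passes the question on to the earlier updates; learning passes it on for the other agent. -/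
theorem skillMem_iff {c : List Token} {a : Agent} {s : Skill} :
    D.lists.skillMem c a s = true ↔ s ∈ D.capsAfter c a := by
  induction c generalizing a with
  | nil => simpa [Lists.skillMem, capsAfter] using D.capMem_iff
  | cons t c ih =>
    simp only [Lists.skillMem] at ih
    simp only [Lists.skillMem, List.foldl_cons]
    by_cases hta : t.2.2 = a
    · obtain ⟨o, l, n⟩ := t
      dsimp only at hta
      subst hta
      rcases o with _ | _ | _ | _ | _ | _ | _ | f
      case op =>
        cases f
        case upskill | downskill =>
          by_cases hs : s ∈ l <;>
            simp [Lists.traceStep, capsAfter, hs, ih, foldl_traceStep_some]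
        case reskill => simp [Lists.traceStep, capsAfter, foldl_traceStep_some]
        all_goals simp [Lists.traceStep, capsAfter, ih]
      all_goals simp [Lists.traceStep, capsAfter, ih]
    · have h1 : Lists.traceStep s (a, none) t = (a, none) := by simp [Lists.traceStep, hta]
      rw [h1, ih]
      obtain ⟨o, l, n⟩ := t
      have h2 : a ≠ n := Ne.symm hta
      rcases o with _ | _ | _ | _ | _ | _ | _ | f
      case op => cases f <;> simp [capsAfter, Function.update_of_ne h2]
      all_goals simp [capsAfter]

/-- No update creates a skill that is not written in the capabilities or in the update itself. This
makes inclusions between sets of skills finite checks. -/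
theorem mem_skills {c : List Token} {a : Agent} {s : Skill} (h : s ∈ D.capsAfter c a) :
    s ∈ D.lists.skills c := by
  simp only [Lists.skills, List.mem_append, List.mem_flatMap]
  induction c generalizing a with
  | nil =>
    obtain ⟨S, hS, hs⟩ := h
    exact .inl ⟨_, hS, hs⟩
  | cons t c ih =>
    have h1 : ∀ b, s ∈ D.capsAfter c b → (∃ x ∈ D.lists.2.2.1, s ∈ x.2) ∨
        ∃ x ∈ t :: c, s ∈ x.2.1 := fun b hb => (ih hb).imp_right fun ⟨x, hx, hs⟩ =>
      ⟨x, List.mem_cons_of_mem _ hx, hs⟩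
    have h2 : s ∈ t.2.1 → (∃ x ∈ D.lists.2.2.1, s ∈ x.2) ∨ ∃ x ∈ t :: c, s ∈ x.2.1 :=
      fun hs => .inr ⟨t, by simp, hs⟩
    obtain ⟨o, l, n⟩ := t
    rcases o with _ | _ | _ | _ | _ | _ | _ | f
    case op =>
      by_cases hn : a = n
      · subst hn
        cases f
        case upskill =>
          simp only [capsAfter, Function.update_self] at h
          exact h.elim (h1 _) h2
        case downskill =>
          simp only [capsAfter, Function.update_self] at h
          exact h1 _ h.1
        case reskill =>
          simp only [capsAfter, Function.update_self] at h
          exact h2 h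
        case learn =>
          simp only [capsAfter, Function.update_self] at h
          exact h1 _ h
        all_goals exact h1 _ h
      · cases f
        case upskill | downskill | reskill | learn =>
          simp only [capsAfter, Function.update_of_ne hn] at h
          exact h1 _ h
        all_goals exact h1 _ h
    all_goals exact h1 _ h

/-- By `hN'` it is enough to test the finitely many listed skills. Updates leave the edges alone, so
these are looked up in the original model. -/
theorem box_iff {c : List Token} {need : Skill → Bool} {N : Set Skill}
    (hN : ∀ s, need s = true ↔ s ∈ N) (hN' : ∀ s ∈ N, s ∈ D.lists.skills c) {P : List Name}
    {u : D.World} : D.lists.box c need P u.1 = true ↔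
      ∀ v : D.World, N ⊆ (D.after c).E u v → v.1 ∈ P := by
  have h : ∀ v : D.World, ((D.lists.skills c).all fun s => !need s || D.lists.edgeMem u.1 v.1 s) =
      true ↔ N ⊆ (D.after c).E u v := by
    intro v
    simp only [List.all_eq_true, Bool.or_eq_true, Bool.not_eq_true', ← Bool.not_eq_true, hN,
      D.edgeMem_iff]
    constructor
    · exact fun h s hs => (h s (hN' s hs)).resolve_left fun h' => h' hs
    · exact fun h s _ => or_iff_not_imp_left.2 fun hs => h (not_not.1 hs)
  rw [Lists.box, List.all_eq_true]
  simp only [Bool.or_eq_true, Bool.not_eq_true', ← Bool.not_eq_true, decide_eq_true_eq]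
  constructor
  · exact fun h' v hv => (h' v.1 v.2).resolve_left fun h'' => h'' ((h v).2 hv)
  · exact fun h' v hv => or_iff_not_imp_left.2 fun h'' => h' ⟨v, hv⟩ ((h ⟨v, hv⟩).1 (not_not.1 h''))

theorem mem_filter_worlds {f : Name → Bool} {u : D.World} :
    u.1 ∈ D.lists.1.filter f ↔ f u.1 = true := by
  simp only [List.mem_filter]
  exact and_iff_right u.2

theorem mem_everyone_iff {c : List Token} {G : List Agent} {P : List Name} {u : D.World} :
    u.1 ∈ D.lists.everyone c G P ↔
      ∀ a ∈ G, (D.after c).Knows a (fun v : D.World => v.1 ∈ P) u := by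
  rw [Lists.everyone, mem_filter_worlds]
  simp only [List.all_eq_true]
  exact forall₂_congr fun a _ => D.box_iff (fun s => D.skillMem_iff) fun s hs => D.mem_skills hs

end ModelData

/-- A decreasing sequence of sets, in which every set determines the next one, is constant from the
number of elements on. -/
theorem subset_of_antitone_of_step {W : Type} [Finite W] {A : ℕ → Set W} {F : Set W → Set W}
    (hA : Antitone A) (hF : ∀ k, A (k + 1) = F (A k)) {m : ℕ} (hm : Nat.card W ≤ m) (n : ℕ) :
    A m ⊆ A n := by
  -- As long as no two consecutive sets agree, each inclusion is strict and costs an element.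
  have h1 : ∀ k, (∃ j < k, A (j + 1) = A j) ∨ (A k).ncard + k ≤ Nat.card W := by
    intro k
    induction k with
    | zero => exact .inr (by simpa using Set.ncard_le_card (A 0))
    | succ k ih =>
      rcases ih with ⟨j, hj, h⟩ | h
      · exact .inl ⟨j, by omega, h⟩
      · by_cases he : A (k + 1) = A k
        · exact .inl ⟨k, by omega, he⟩
        · have := Set.ncard_lt_ncard ((hA (k.le_add_right 1)).ssubset_of_ne he)
          exact .inr (by omega)
  -- For `k = m + 1` the cardinalities rule out the second alternative, so a repetition occurs at
  -- some `j ≤ m`.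
  obtain ⟨j, hj, h⟩ := (h1 (m + 1)).resolve_right (by omega)
  have h2 : ∀ i, A (j + i) = A j := by
    intro i
    induction i with
    | zero => rfl
    | succ i ih => rw [← add_assoc, hF, ih, ← hF, h]
  rcases le_total n j with hn | hn
  · exact hA (by omega)
  · obtain ⟨i, rfl⟩ := Nat.exists_eq_add_of_le hn
    rw [h2]
    exact hA (by omega)

namespace ModelData

variable (D : ModelData)

/-- Let `A k` be the set where `E^n P` holds for `1 ≤ n ≤ k`. As `E` commutes with conjunctions, `A
(k + 1)` is `E` of `P ∩ A k`, which is the step of the algorithm. The list of worlds may contain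
repetitions, but its length is at least the number of worlds, so enough steps are made. -/
theorem mem_common_iff {c : List Token} {l : List Agent} {G : Group} (hG : l.toFinset = G.1)
    {P : List Name} {u : D.World} : u.1 ∈ D.lists.common c l P ↔
      ∀ n : ℕ, 1 ≤ n → ((D.after c).EveryoneKnows G)^[n] (fun v : D.World => v.1 ∈ P) u := by
  set E := (D.after c).EveryoneKnows G with hE
  have hEl : ∀ (Q : List Name) (u : D.World), u.1 ∈ D.lists.everyone c l Q ↔
      E (fun v => v.1 ∈ Q) u := by
    intro Q u
    rw [mem_everyone_iff, hE]
    simp only [WeightedModel.EveryoneKnows, ← hG, List.mem_toFinset]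
  have hEand : ∀ (p : ℕ → D.World → Prop) (u : D.World) (k : ℕ),
      E (fun v => ∀ n ≤ k, p n v) u ↔ ∀ n ≤ k, E (p n) u :=
    fun p u k => ⟨fun h n hn a ha v hv => h a ha v hv n hn, fun h a ha v hv n hn =>
        h n hn a ha v hv⟩
  let A : ℕ → Set D.World := fun k => {u | ∀ n, 1 ≤ n → n ≤ k → E^[n] (fun v => v.1 ∈ P) u}
  have hA : Antitone A := fun i j hij u hu n hn hn' => hu n hn (hn'.trans hij)
  have hstep : ∀ k u, u ∈ A (k + 1) ↔ E (fun v => v.1 ∈ P ∧ v ∈ A k) u := by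
    intro k u
    have h1 : (fun v : D.World => v.1 ∈ P ∧ v ∈ A k) =
        fun v => ∀ n ≤ k, E^[n] (fun v => v.1 ∈ P) v := by
      funext v
      refine propext ⟨fun h n hn => ?_, fun h => ⟨h 0 (Nat.zero_le _), fun n _ hn => h n hn⟩⟩
      rcases n with _ | n
      · exact h.1
      · exact h.2 _ (by omega) hn
    rw [h1, hEand]
    constructor
    · intro h n hn
      rw [← Function.iterate_succ_apply' E]
      exact h (n + 1) (by omega) (by omega)
    · rintro h (_ | n) hn hn'
      · omega
      · rw [Function.iterate_succ_apply']
        exact h n (by omega)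
  have hmem : ∀ (m : List Name) (u : D.World),
      u.1 ∈ m.foldl (fun Q _ => D.lists.everyone c l (P.filter fun u => decide (u ∈ Q)))
        D.lists.1 ↔ u ∈ A m.length := by
    intro m
    induction m using List.reverseRecOn with
    -- `A 0` is an empty conjunction, which is why the iteration starts with all worlds.
    | nil => exact fun u => iff_of_true u.2 fun n hn hn' => absurd (hn.trans hn') (by simp)
    | append_singleton m a ih =>
      intro u
      rw [List.foldl_append, List.foldl_cons, List.foldl_nil, hEl, List.length_append,
        List.length_singleton, hstep]
      simp only [List.mem_filter, decide_eq_true_eq, ih]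
  have hfin : Finite D.World := D.worlds.finite_toSet
  have hcard : Nat.card D.World ≤ D.lists.1.length := by
    have h : Nat.card D.World = D.worlds.toFinset.card :=
      (Nat.subtype_card D.worlds.toFinset fun _ => List.mem_toFinset)
    exact h.trans_le (List.toFinset_card_le _)
  rw [Lists.common, hmem]
  constructor
  · intro h n hn
    exact subset_of_antitone_of_step hA (F := fun S => {u | E (fun v => v.1 ∈ P ∧ v ∈ S) u})
      (fun k => Set.ext (hstep k)) hcard n h n hn le_rfl
  · exact fun h n hn _ => h n hn

end ModelData
end WeightedEpistemic

/-! ### Token sequences and formulas: evaluation, unique reading, correctness of the decision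
procedure -/

namespace WeightedEpistemic

namespace ModelData

/-- The algorithm evaluates the tokens `ts` to the set of worlds at which `φ` is true, whatever the
updates are in whose scope they are. -/
def Evaluates (D : ModelData) (φ : Formula) (ts : List Token) : Prop :=
  ∀ c, ∃ (o : List (Token × List Token)) (P : List Name),
    (∀ cs out, ts.foldl annotateStep (c :: cs, out) = (cs, o ++ out)) ∧
    (∀ vs, o.foldl D.lists.evalStep vs = P :: vs) ∧
    ∀ u : D.World, u.1 ∈ P ↔ φ.Sat (D.after c) u

/-- `f` gives the updates in whose scope the argument stands: it is the identity, except that an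
update modality adds its own token. Annotation reverses the order, so the operator is evaluated
after its argument. -/
theorem Evaluates.unary {D : ModelData} {φ ψ : Formula} {ts : List Token} {t : Token}
    (h : D.Evaluates φ ts) (f : List Token → List Token)
    (hf : ∀ c cs out, annotateStep (c :: cs, out) t = (f c :: cs, (t, c) :: out))
    (ht : ∀ c P, (∀ u : D.World, u.1 ∈ P ↔ φ.Sat (D.after (f c)) u) →
      ∃ P', (∀ vs, D.lists.evalStep (P :: vs) (t, c) = P' :: vs) ∧
        ∀ u : D.World, u.1 ∈ P' ↔ ψ.Sat (D.after c) u) : D.Evaluates ψ (t :: ts) := by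
  intro c
  obtain ⟨o, P, h1, h2, h3⟩ := h (f c)
  obtain ⟨P', h4, h5⟩ := ht c P h3
  refine ⟨o ++ [(t, c)], P', fun cs out => ?_, fun vs => ?_, h5⟩
  · rw [List.foldl_cons, hf, h1]
    simp
  · rw [List.foldl_append, h2]
    exact h4 vs

end ModelData

/-- `ts` are the tokens of the formula `φ`, written as `x`. -/
structure IsTokens (X : Set Feature) (φ : Formula) (x : List Sym) (ts : List Token) : Prop where
  valid : ∀ t ∈ ts, t.Valid
  allowed : ∀ t ∈ ts, t.allowed X = true
  eq_flatMap : x = ts.flatMap Token.write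
  count (n : List Unit) : ts.foldr countStep (some n) = some (() :: n)
  evaluates (D : ModelData) : D.Evaluates φ ts

theorem IsTokens.unary {X : Set Feature} {φ ψ : Formula} {x y : List Sym} {ts : List Token}
    {t : Token} (h : IsTokens X φ x ts) (hV : t.Valid) (hX : t.allowed X = true)
    (hy : y = t.write ++ x) (ht : ∀ n, countStep t (some (() :: n)) = some (() :: n))
    (hψ : ∀ D, ModelData.Evaluates D φ ts → ModelData.Evaluates D ψ (t :: ts)) :
    IsTokens X ψ y (t :: ts) where
  valid := List.forall_mem_cons.2 ⟨hV, h.valid⟩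
  allowed := List.forall_mem_cons.2 ⟨hX, h.allowed⟩
  eq_flatMap := by rw [hy, h.eq_flatMap, List.flatMap_cons]
  count n := by rw [List.foldr_cons, h.count, ht]
  evaluates D := hψ D (h.evaluates D)

theorem isEmpty_eq_false_of_toFinset {l : List Agent} {G : Group} (h : l.toFinset = G.1) :
    l.isEmpty = false := by
  have := G.2
  rw [← h] at this
  rcases l with _ | _
  · simp at this
  · rfl

theorem mem_iff_of_toFinset {l : List Name} {G : Finset Name} (h : l.toFinset = G) (a : Name) :
    a ∈ l ↔ a ∈ G := by
  rw [← h, List.mem_toFinset]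

/-- The induction is on the way of writing and not on the formula, because the tokens keep the order
in which the elements of a finite set are listed. -/
theorem Formula.WrittenAs.exists_isTokens {X : Set Feature} {φ : Formula} {x : List Sym}
    (h : φ.WrittenAs x) (hφ : φ.InLanguage X) : ∃ ts, IsTokens X φ x ts := by
  have hset : ∀ {l : List Skill} {S : Finset Skill}, l.toFinset = S →
      {s | s ∈ l} = (S : Set Skill) := fun h => Set.ext fun s => mem_iff_of_toFinset h s
  induction h with
  | atom p =>
    refine ⟨[(.stop_mark, [], p)], by simp [Token.Valid], by simp [Token.allowed],
      by simp [Token.write], fun n => rfl, fun D c => ⟨[((.stop_mark, [], p), c)],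
        D.lists.1.filter (fun u => D.lists.valMem u p), fun cs out => rfl, fun vs => rfl,
        fun u => ?_⟩⟩
    rw [D.mem_filter_worlds, D.valMem_iff]
    rfl
  | neg h ih =>
    obtain ⟨ts, h⟩ := ih hφ
    refine ⟨_, h.unary (t := (.neg, [], [])) ⟨rfl, rfl⟩ rfl rfl (fun n => rfl) fun D hD =>
      hD.unary id (fun c cs out => rfl) fun c P hP => ⟨D.lists.1.filter fun u => !decide (u ∈ P),
        fun vs => rfl, fun u => ?_⟩⟩
    rw [D.mem_filter_worlds]
    simp [Formula.Sat, hP]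
  | @imp φ ψ x y h h' ih ih' =>
    obtain ⟨ts, h⟩ := ih hφ.1
    obtain ⟨ts', h'⟩ := ih' hφ.2
    refine ⟨(.imp, [], []) :: (ts ++ ts'), ?_, ?_, ?_, fun n => ?_, fun D c => ?_⟩
    · exact List.forall_mem_cons.2 ⟨⟨rfl, rfl⟩, List.forall_mem_append.2 ⟨h.valid, h'.valid⟩⟩
    · exact List.forall_mem_cons.2 ⟨rfl, List.forall_mem_append.2 ⟨h.allowed, h'.allowed⟩⟩
    · simp [h.eq_flatMap, h'.eq_flatMap, Token.write]
    · simp [h.count, h'.count, countStep]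
    · obtain ⟨o, P, h1, h2, h3⟩ := h.evaluates D c
      obtain ⟨o', P', h1', h2', h3'⟩ := h'.evaluates D c
      -- Annotated tokens come out latest first, so the consequent is evaluated before the
      -- antecedent, whose set `P` is then on top.
      refine ⟨o' ++ o ++ [((.imp, [], []), c)],
        D.lists.1.filter fun u => !decide (u ∈ P) || decide (u ∈ P'),
        fun cs out => ?_, fun vs => ?_, fun u => ?_⟩
      · have : annotateStep (c :: cs, out) (.imp, [], []) =
          (c :: c :: cs, ((.imp, [], []), c) :: out) := rfl
        rw [List.foldl_cons, this, List.foldl_append, h1, h1']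
        simp
      · rw [List.foldl_append, List.foldl_append, h2', h2]
        rfl
      · rw [D.mem_filter_worlds]
        simp [Formula.Sat, h3, h3', imp_iff_not_or]
  | know a h ih =>
    obtain ⟨ts, h⟩ := ih hφ
    refine ⟨_, h.unary (t := (.know, [], a)) rfl rfl (by simp [Token.write]) (fun n => rfl)
      fun D hD => hD.unary id (fun c cs out => rfl) fun c P hP => ⟨D.lists.everyone c [a] P,
        fun vs => rfl, fun u => ?_⟩⟩
    rw [D.mem_everyone_iff]
    simp [Formula.Sat, hP]
  | common G l hl h ih =>
    obtain ⟨ts, h⟩ := ih hφ.2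
    refine ⟨_, h.unary (t := (.op .common, l, [])) rfl
      (by simpa [Token.allowed, isEmpty_eq_false_of_toFinset hl] using hφ.1) (by simp [Token.write])
      (fun n => rfl) fun D hD => hD.unary id (fun c cs out => rfl) fun c P hP =>
      ⟨D.lists.common c l P,
        fun vs => rfl, fun u => ?_⟩⟩
    refine (D.mem_common_iff hl).trans ?_
    simp only [hP]
    rfl
  | distributed G l hl h ih =>
    obtain ⟨ts, h⟩ := ih hφ.2
    refine ⟨_, h.unary (t := (.op .distributed, l, [])) rfl
      (by simpa [Token.allowed, isEmpty_eq_false_of_toFinset hl] using hφ.1) (by simp [Token.write])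
      (fun n => rfl) fun D hD => hD.unary id (fun c cs out => rfl) fun c P hP =>
      ⟨D.lists.1.filter fun u =>
        D.lists.box c (fun s => l.any fun a => D.lists.skillMem c a s) P u,
        fun vs => rfl, fun u => ?_⟩⟩
    rw [D.mem_filter_worlds]
    refine (D.box_iff (N := ⋃ a ∈ G.1, D.capsAfter c a) (fun s => ?_) fun s hs => ?_).trans ?_
    · simp [D.skillMem_iff, mem_iff_of_toFinset hl]
    · simp only [Set.mem_iUnion] at hs
      obtain ⟨a, _, hs⟩ := hs
      exact D.mem_skills hs
    · simp only [hP]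
      rfl
  | field G l hl h ih =>
    obtain ⟨ts, h⟩ := ih hφ.2
    refine ⟨_, h.unary (t := (.op .field, l, [])) rfl
      (by simpa [Token.allowed, isEmpty_eq_false_of_toFinset hl] using hφ.1) (by simp [Token.write])
      (fun n => rfl) fun D hD => hD.unary id (fun c cs out => rfl) fun c P hP =>
      ⟨D.lists.1.filter fun u =>
        D.lists.box c (fun s => l.all fun a => D.lists.skillMem c a s) P u,
        fun vs => rfl, fun u => ?_⟩⟩
    rw [D.mem_filter_worlds]
    refine (D.box_iff (N := ⋂ a ∈ G.1, D.capsAfter c a) (fun s => ?_) fun s hs => ?_).trans ?_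
    · simp [D.skillMem_iff, mem_iff_of_toFinset hl]
    · simp only [Set.mem_iInter] at hs
      -- An empty intersection would contain all skills; a member of the group puts it inside the
      -- listed ones.
      obtain ⟨a, ha⟩ := G.2
      exact D.mem_skills (hs a ha)
    · simp only [hP]
      rfl
  | upskill S l a hl h ih =>
    obtain ⟨ts, h⟩ := ih hφ.2
    refine ⟨_, h.unary (t := (.op .upskill, l, a)) trivial (by simpa [Token.allowed] using hφ.1)
      (by simp [Token.write]) (fun n => rfl) fun D hD => hD.unary
          (fun c => (.op .upskill, l, a) :: c)
      (fun c cs out => rfl) fun c P hP => ⟨P, fun vs => rfl, fun u => (hP u).trans ?_⟩⟩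
    simp only [Formula.Sat, ← hset hl]
    rfl
  | downskill S l a hl h ih =>
    obtain ⟨ts, h⟩ := ih hφ.2
    refine ⟨_, h.unary (t := (.op .downskill, l, a)) trivial (by simpa [Token.allowed] using hφ.1)
      (by simp [Token.write]) (fun n => rfl) fun D hD =>
      hD.unary (fun c => (.op .downskill, l, a) :: c)
      (fun c cs out => rfl) fun c P hP => ⟨P, fun vs => rfl, fun u => (hP u).trans ?_⟩⟩
    simp only [Formula.Sat, ← hset hl]
    rfl
  | reskill S l a hl h ih =>
    obtain ⟨ts, h⟩ := ih hφ.2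
    refine ⟨_, h.unary (t := (.op .reskill, l, a)) trivial (by simpa [Token.allowed] using hφ.1)
      (by simp [Token.write]) (fun n => rfl) fun D hD => hD.unary
          (fun c => (.op .reskill, l, a) :: c)
      (fun c cs out => rfl) fun c P hP => ⟨P, fun vs => rfl, fun u => (hP u).trans ?_⟩⟩
    simp only [Formula.Sat, ← hset hl]
    rfl
  | learn b a h ih =>
    obtain ⟨ts, h⟩ := ih hφ.2
    exact ⟨_, h.unary (t := (.op .learn, [b], a)) ⟨b, rfl⟩ (by simpa [Token.allowed] using hφ.1)
      (by simp [Token.write]) (fun n => rfl) fun D hD => hD.unary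
          (fun c => (.op .learn, [b], a) :: c)
      (fun c cs out => rfl) fun c P hP => ⟨P, fun vs => rfl, fun u => (hP u).trans Iff.rfl⟩⟩
  -- The remaining case is mutual knowledge.
  | _ =>
    rename_i G l φ x hl h ih
    obtain ⟨ts, h⟩ := ih hφ.2
    refine ⟨_, h.unary (t := (.op .mutual, l, [])) rfl
      (by simpa [Token.allowed, isEmpty_eq_false_of_toFinset hl] using hφ.1) (by simp [Token.write])
      (fun n => rfl) fun D hD => hD.unary id (fun c cs out => rfl) fun c P hP =>
      ⟨D.lists.everyone c l P, fun vs => rfl, fun u => ?_⟩⟩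
    rw [D.mem_everyone_iff]
    simp only [hP, mem_iff_of_toFinset hl]
    rfl

/-- In Polish notation, read from the right, the count is the number of complete formulas spelled so
far: an atom adds one, an implication joins two, other operators extend the first. If the count
never lacks an argument, the sequence is a concatenation of formulas. -/
theorem exists_formulas {X : Set Feature} {ts : List Token} (hV : ∀ t ∈ ts, t.Valid)
    (hX : ∀ t ∈ ts, t.allowed X = true) {n : List Unit}
    (h : ts.foldr countStep (some []) = some n) :
    ∃ l : List (Formula × List Sym), l.length = n.length ∧
      (∀ y ∈ l, y.1.InLanguage X ∧ y.1.WrittenAs y.2) ∧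
      ts.flatMap Token.write = l.flatMap fun y => y.2 := by
  induction ts generalizing n with
  | nil =>
    obtain rfl : [] = n := by simpa using h
    exact ⟨[], rfl, by simp, rfl⟩
  | cons t ts ih =>
    simp only [List.forall_mem_cons] at hV hX
    rw [List.foldr_cons, countStep, Option.bind_eq_some_iff] at h
    obtain ⟨m, hm, h⟩ := h
    obtain ⟨l, hl, hφ, hw⟩ := ih hV.2 hX.2 hm
    rw [List.flatMap_cons, hw]
    obtain ⟨hV, -⟩ := hV
    obtain ⟨hX, -⟩ := hX
    have unary : (bif m.isEmpty then none else some m) = some n →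
        (∀ (φ : Formula) (x : List Sym), φ.InLanguage X → φ.WrittenAs x →
          ∃ ψ : Formula, ψ.InLanguage X ∧ ψ.WrittenAs (t.write ++ x)) →
        ∃ l' : List (Formula × List Sym), l'.length = n.length ∧
          (∀ y ∈ l', y.1.InLanguage X ∧ y.1.WrittenAs y.2) ∧
          t.write ++ l.flatMap (fun y => y.2) = l'.flatMap fun y => y.2 := by
      intro h hψ
      rcases l with _ | ⟨⟨φ, x⟩, l⟩
      · rw [List.length_nil, eq_comm, List.length_eq_zero_iff] at hl
        simp [hl] at h
      · rcases m with _ | ⟨_, m⟩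
        · simp at h
        · obtain rfl : _ = n := by simpa using h
          simp only [List.forall_mem_cons] at hφ
          obtain ⟨ψ, h1, h2⟩ := hψ φ x hφ.1.1 hφ.1.2
          exact ⟨(ψ, t.write ++ x) :: l, hl, List.forall_mem_cons.2 ⟨⟨h1, h2⟩, hφ.2⟩, by simp⟩
    have group : ∀ g : List Agent, (!g.isEmpty) = true → ∃ G : Group, g.toFinset = G.1 := by
      intro g hg
      exact ⟨⟨g.toFinset, by simpa [List.isEmpty_iff] using hg⟩, rfl⟩
    obtain ⟨s, g, a⟩ := t
    rcases s with _ | _ | _ | _ | _ | _ | _ | f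
    case bit | bra | ket => exact hV.elim
    case stop_mark =>
      obtain rfl : _ = n := by simpa using h
      exact ⟨(.atom a, writeName a) :: l, by simp [hl],
        List.forall_mem_cons.2 ⟨⟨trivial, .atom a⟩, hφ⟩, by simp [Token.write]⟩
    case neg => exact unary h fun φ x h1 h2 => ⟨.neg φ, h1, h2.neg⟩
    case imp =>
      -- With fewer than two formulas to the right, `countStep` returns `none`, which contradicts
      -- `h`.
      rcases l with _ | ⟨⟨φ, x⟩, _ | ⟨⟨ψ, y⟩, l⟩⟩
      · rcases m with _ | ⟨_, m⟩ <;> simp at h hl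
      · rcases m with _ | ⟨_, _ | ⟨_, m⟩⟩ <;> simp at h hl
      · rcases m with _ | ⟨_, _ | ⟨_, m⟩⟩
        · simp at h
        · simp at h
        · obtain rfl : _ = n := by simpa using h
          simp only [List.forall_mem_cons] at hφ
          exact ⟨(.imp φ ψ, .imp :: (x ++ y)) :: l, by simpa using hl,
            List.forall_mem_cons.2 ⟨⟨⟨hφ.1.1, hφ.2.1.1⟩, .imp hφ.1.2 hφ.2.1.2⟩, hφ.2.2⟩,
            by simp [Token.write]⟩
    case know => exact unary h fun φ x h1 h2 => ⟨.know a φ, h1, h2.know a⟩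
    case op =>
      refine unary h fun φ x h1 h2 => ?_
      cases f
      case common =>
        simp only [Token.allowed, Bool.and_eq_true, decide_eq_true_eq] at hX
        obtain ⟨G, hG⟩ := group g hX.2
        exact ⟨.common G φ, ⟨hX.1, h1⟩, h2.common G g hG⟩
      case distributed =>
        simp only [Token.allowed, Bool.and_eq_true, decide_eq_true_eq] at hX
        obtain ⟨G, hG⟩ := group g hX.2
        exact ⟨.distributed G φ, ⟨hX.1, h1⟩, h2.distributed G g hG⟩
      case field =>
        simp only [Token.allowed, Bool.and_eq_true, decide_eq_true_eq] at hX
        obtain ⟨G, hG⟩ := group g hX.2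
        exact ⟨.field G φ, ⟨hX.1, h1⟩, h2.field G g hG⟩
      case upskill =>
        exact ⟨.upskill _ a φ, ⟨by simpa [Token.allowed] using hX, h1⟩, by
          simpa [Token.write] using h2.upskill _ g a rfl⟩
      case downskill =>
        exact ⟨.downskill _ a φ, ⟨by simpa [Token.allowed] using hX, h1⟩, by
          simpa [Token.write] using h2.downskill _ g a rfl⟩
      case reskill =>
        exact ⟨.reskill _ a φ, ⟨by simpa [Token.allowed] using hX, h1⟩, by
          simpa [Token.write] using h2.reskill _ g a rfl⟩
      case learn =>
        obtain ⟨b, rfl⟩ := hV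
        exact ⟨.learn b a φ, ⟨by simpa [Token.allowed] using hX, h1⟩, by
          simpa [Token.write] using h2.learn b a⟩
      simp only [Token.allowed, Bool.and_eq_true, decide_eq_true_eq] at hX
      obtain ⟨G, hG⟩ := group g hX.2
      exact ⟨.mutual G φ, ⟨hX.1, h1⟩, h2.mutual G g hG⟩

theorem check_eq_true_iff (X : Set Feature) (z : List Sym) :
    check X z = true ↔ z ∈ modelChecking X := by
  have main : ∀ (D : ModelData) (w : D.World) (φ : Formula) (x : List Sym) (ts : List Token),
      IsTokens X φ x ts → (w.1 ∈ D.lists.eval ts ↔ φ.Sat D.toModel w) := by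
    intro D w φ x ts h
    obtain ⟨o, P, h1, h2, h3⟩ := h.evaluates D []
    simp only [Lists.eval, h1, List.append_nil, h2, List.headD_cons]
    exact h3 w
  simp only [check]
  constructor
  · intro h
    rcases hz : Parsing.input z with _ | ⟨⟨L, w⟩, ts⟩
    · simp [hz] at h
    · obtain ⟨hV, rfl⟩ := Parsing.input_eq_some_iff.1 hz
      rw [hz] at h
      simp only [Option.elim_some, Bool.and_eq_true, decide_eq_true_eq, isFormula,
        List.all_eq_true] at h
      obtain ⟨⟨hw, hX, hn⟩, h⟩ := h
      rcases hc : ts.foldr countStep (some []) with _ | n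
      · simp [hc] at hn
      · obtain ⟨l, hl, hφ, hts⟩ := exists_formulas hV hX hc
        have hn1 : n.length = 1 := by
          rw [hc] at hn
          rcases n with _ | ⟨_, _ | _⟩ <;> simp at hn ⊢
        obtain ⟨⟨φ, x⟩, rfl⟩ := List.length_eq_one_iff.1 (hl.trans hn1)
        simp only [List.mem_singleton, forall_eq, List.flatMap_cons, List.flatMap_nil,
          List.append_nil] at hφ hts
        obtain ⟨ts', h'⟩ := hφ.2.exists_isTokens hφ.1
        -- The parser does not check that there is a world; the membership of `w` ensures it.
        let D : ModelData := ⟨L.1, List.ne_nil_of_mem hw, L.2.1, L.2.2.1, L.2.2.2⟩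
        have hD : D.lists = L := rfl
        -- Unique readability: both sequences spell the same string, and the parser is a function.
        have hts' : ts' = ts := by
          have h1 := (Parsing.input_eq_some_iff (D := L) (w := w)).2 ⟨h'.valid, rfl⟩
          rw [← h'.eq_flatMap, ← hts, hz] at h1
          simpa using h1.symm
        subst hts'
        refine ⟨D, ⟨w, hw⟩, φ, x, hφ.1, hφ.2, ?_, (main D ⟨w, hw⟩ φ x _ h').1 h⟩
        rw [← D.write_lists, hD, hts]
  · rintro ⟨D, w, φ, x, hφ, hx, rfl, h⟩
    obtain ⟨ts, h'⟩ := hx.exists_isTokens hφ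
    have h1 := (Parsing.input_eq_some_iff (D := D.lists) (w := w.1)).2 ⟨h'.valid, rfl⟩
    rw [← h'.eq_flatMap, D.write_lists] at h1
    rw [h1]
    have h2 : w.1 ∈ D.lists.1 := w.2
    have h3 : isFormula X ts = true := by
      simpa [isFormula, h'.count] using h'.allowed
    simp [h2, h3, main D w φ x ts h', h]

end WeightedEpistemic

theorem mainTheorem1 (X : Set WeightedEpistemic.Feature) :
    WeightedEpistemic.InP (WeightedEpistemic.modelChecking X) :=
  WeightedEpistemic.inP_of_polyTime (WeightedEpistemic.polyTime_check X)
    (WeightedEpistemic.check_eq_true_iff X)
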